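/- Let $\mathcal G=(\mathcal V,\mathcal E)$ be a strongly connected digraph with $N\ge 2$ nodes, and put $m=N-1$. Let $\mathcal L$ be its Laplacian, $(\mathcal L e)_i=\sum_{k:(k,i)\in\mathcal E}(e_i-e_k)$. Let $\mathcal T=[v_1,\mathcal T_1]\in\mathbb R^{N\times N}$ be nonsingular with $v_1=\frac1{\sqrt N}\mathbf 1_N$ and $\mathcal T^{-1}\mathcal L\mathcal T=\begin{bmatrix}0&0\\0&\bar{\mathcal L}\end{bmatrix}$, $\bar{\mathcal L}\in\mathbb R^{m\times m}$. Let $T_2\ge T_1>0$, $\mu>0$, $h\in\mathbb R$, $\gamma>0$, and define $$A_{f_1}=\begin{bmatrix}0&1\\0&h\end{bmatrix},\quad A_{f_2}=\begin{bmatrix}0&I_m\\0&hI_m\end{bmatrix},\quad A_{f_3}=\begin{bmatrix}0&\mu\\-1&-1\end{bmatrix},\quad A_{f_4}=\begin{bmatrix}0&\mu I_m\\-I_m&-I_m\end{bmatrix},$$ $$B_{f_1}=A_{g_1}=\begin{bmatrix}1&0\\0&0\end{bmatrix},\quad B_{f_2}=\begin{bmatrix}I_m&0\\0&0\end{bmatrix},\quad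 A_{g_2}=\begin{bmatrix}I_m&0\\-\gamma\bar{\mathcal L}&0\end{bmatrix}.$$ Let $P_1,P_3\in\mathbb R^{2m\times2m}$ and $P_2\in\mathbb R^{2\times2}$ be symmetric positive definite. Write $Q(\nu)=\exp(A_{f_2}^\top\nu)P_1\exp(A_{f_2}\nu)$, and let $|\cdot|$ denote the spectral norm of matrices and the Euclidean norm of vectors. Assume that $$A_{g_2}^\top Q(\nu)A_{g_2}-P_1\prec0\qquad\text{for all }\nu\in[T_1,T_2],$$ and that for some $\epsilon>0$, some $\beta_2>0$ with $P_3A_{f_4}+A_{f_4}^\top P_3\preceq-\beta_2I_{2m}$, and some $\kappa_2\in\Big(0,-\min_{\nu\in[T_1,T_2]}\lambda_{\min}\big(A_{g_2}^\top Q(\nu)A_{g_2}-P_1\big)\Big)$, $$\Big|\exp\Big(\frac{\bar\kappa_1}{\alpha_2}T_2\Big)\Big(1-\frac{\bar\kappa_2}{\alpha_2}\Big)\Big|<1,$$ where $\kappa_1=2\max_{\nu\in[0,T_2]}|Q(\nu)|$, $\bar\kappa_1=\max\{\frac{\kappa_1}{2\epsilon},\frac{\kappa_1\epsilon}2-\beta_2\}$,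 $\bar\kappa_2=\min\{1,\kappa_2\}$ and $\alpha_2=\max_{\nu\in[0,T_2]}\max\{e^{2h\nu},\lambda_{\max}(Q(\nu)),\lambda_{\max}(P_2),\lambda_{\max}(P_3)\}$. Consider the hybrid system $\widetilde{\mathcal H}_{m_\sigma}$ with state $\chi=(\bar z_1,\bar z_2,\bar w_1,\bar w_2,\tau)\in\mathcal X_\varepsilon:=\mathbb R^2\times\mathbb R^{2m}\times\mathbb R^2\times\mathbb R^{2m}\times[0,T_2]$ and input $\bar m_\sigma=(\bar m_{\sigma_1},\bar m_{\sigma_2})\in\mathbb R\times\mathbb R^m$ (the transformed error $\mathcal T^{-1}(\sigma_i-\sigma^*)_{i\in\mathcal V}$ on the injected clock-rate reference), given by $$\begin{aligned}\dot{\bar z}_1&=A_{f_1}\bar z_1+B_{f_1}\bar w_1+(\bar m_{\sigma_1},0),\quad&\dot{\bar z}_2&=A_{f_2}\bar z_2+B_{f_2}\bar w_2+(\bar m_{\sigma_2},0),\\ \dot{\bar w}_1&=A_{f_3}\bar w_1,\quad\dot{\bar w}_2=A_{f_4}\bar w_2,&\dot\tau&=-1\end{aligned}\qquad\text{for }\chi\in\mathcal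 X_\varepsilon,$$ $$\bar z_1^+=A_{g_1}\bar z_1,\quad\bar z_2^+=A_{g_2}\bar z_2,\quad\bar w_1^+=\bar w_1,\quad\bar w_2^+=\bar w_2,\quad\tau^+\in[T_1,T_2]\qquad\text{for }\chi\in\mathcal X_\varepsilon\text{ with }\tau=0.$$ Then $\widetilde{\mathcal H}_{m_\sigma}$ is input-to-state stable with respect to $$\widetilde{\mathcal A}_\varepsilon=\{\chi\in\mathcal X_\varepsilon:\ \bar z_1=(e^*,0)\text{ for some }e^*\in\mathbb R,\ \bar z_2=0,\ \bar w_1=0,\ \bar w_2=0\},$$ that is, there are $\beta\in\mathcal{KL}$ and $\kappa\in\mathcal K$ such that every solution pair $(\phi,\bar m_\sigma)$, with $\bar m_\sigma$ essentially bounded, satisfies $$|\phi(t,j)|_{\widetilde{\mathcal A}_\varepsilon}\le\max\{\beta(|\phi(0,0)|_{\widetilde{\mathcal A}_\varepsilon},t+j),\ \kappa(|\bar m_\sigma|_\infty)\}\qquad\text{for all }(t,j)\in\operatorname{dom}\phi,$$ where $|x|_{\widetilde{\mathcal A}_\varepsilon}$ is the Euclidean distance from $x$ to $\widetilde{\mathcal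 A}_\varepsilon$. -/

import Mathlib

open Set Filter Topology MeasureTheory Matrix

namespace HyNTP

noncomputable section

/-! ## Comparison functions -/

/-- Class `𝒦`: continuous strictly increasing functions `[0,∞) → [0,∞)` vanishing at `0`. -/
structure IsClassK (κ : ℝ → ℝ) : Prop where
  continuousOn : ContinuousOn κ (Ici 0)
  strictMonoOn : StrictMonoOn κ (Ici 0)
  map_zero : κ 0 = 0

/-- Class `𝒦ℒ`: continuous functions `β : [0,∞) × [0,∞) → [0,∞)` such that `β(·,s)` is of
class `𝒦` for every `s ≥ 0` and `β(r,·)` is nonincreasing with limit `0` for every `r ≥ 0`. -/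
structure IsClassKL (β : ℝ → ℝ → ℝ) : Prop where
  continuousOn : ContinuousOn (fun p : ℝ × ℝ => β p.1 p.2) (Ici 0 ×ˢ Ici 0)
  classK : ∀ s, 0 ≤ s → IsClassK (fun r => β r s)
  antitoneOn : ∀ r, 0 ≤ r → AntitoneOn (β r) (Ici 0)
  tendsto_zero : ∀ r, 0 ≤ r → Tendsto (β r) atTop (𝓝 0)

/-! ## Hybrid systems with inputs -/

/-- A hybrid system with state in `X` and input in `U`:
flow set `C`, flow map `f`, jump set `D`, set-valued jump map `G`. -/
structure HybridSystem (X U : Type*) where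
  C : Set X
  f : X → U → X
  D : Set X
  G : X → U → Set X

/-- Hybrid time domains: nonempty subsets `E` of `[0,∞) × ℕ` such that for each `(T,J) ∈ E` the
set `E ∩ ([0,T] × {0,…,J})` is `⋃_{j ≤ J} [s j, s (j+1)] × {j}` for some
`0 = s 0 ≤ s 1 ≤ ⋯ ≤ s (J+1)`. -/
structure IsHybridTimeDomain (E : Set (ℝ × ℕ)) : Prop where
  nonempty : E.Nonempty
  nonneg : ∀ p ∈ E, 0 ≤ p.1
  truncation : ∀ T J, (T, J) ∈ E → ∃ s : ℕ → ℝ, s 0 = 0 ∧ (∀ j ≤ J, s j ≤ s (j + 1)) ∧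
    E ∩ (Icc 0 T ×ˢ Iic J) = {p | p.2 ≤ J ∧ p.1 ∈ Icc (s p.2) (s (p.2 + 1))}

/-- The interval `I^j = {t : (t,j) ∈ E}`. -/
def timeSlice (E : Set (ℝ × ℕ)) (j : ℕ) : Set ℝ := {t | (t, j) ∈ E}

/-- The points of the hybrid time domain from which a jump occurs. -/
def jumpPoints (E : Set (ℝ × ℕ)) : Set (ℝ × ℕ) := {p | p ∈ E ∧ (p.1, p.2 + 1) ∈ E}

/-- `φ` is a hybrid arc with domain `E` (only the values of `φ` on `E` matter). -/
structure IsHybridArc {X : Type*} [PseudoMetricSpace X] (E : Set (ℝ × ℕ)) (φ : ℝ → ℕ → X) :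
    Prop where
  domain : IsHybridTimeDomain E
  locallyAbsolutelyContinuous : ∀ j a b, a ≤ b → Icc a b ⊆ timeSlice E j →
    AbsolutelyContinuousOnInterval (fun t => φ t j) a b

/-- `u` is a hybrid input with domain `E`: on every interval `I^j` it is Lebesgue measurable and
locally essentially bounded. -/
structure IsHybridInput {U : Type*} [NormedAddCommGroup U] (E : Set (ℝ × ℕ)) (u : ℝ → ℕ → U) :
    Prop where
  domain : IsHybridTimeDomain E
  measurable : ∀ j, AEStronglyMeasurable (fun t => u t j) (volume.restrict (timeSlice E j))
  locallyEssBounded : ∀ j a b, Icc a b ⊆ timeSlice E j →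
    eLpNorm (fun t => u t j) ⊤ (volume.restrict (Icc a b)) < ⊤

/-- The sup norm `|u|_∞ ∈ [0,∞]` of a hybrid input: the essential supremum along flows, together
with the supremum over the jump points. -/
def inputNorm {U : Type*} [NormedAddCommGroup U] (E : Set (ℝ × ℕ)) (u : ℝ → ℕ → U) : ENNReal :=
  max (⨆ j, eLpNorm (fun t => u t j) ⊤ (volume.restrict (timeSlice E j)))
    (⨆ p ∈ jumpPoints E, ‖u p.1 p.2‖ₑ)

/-- `(φ, u)` is a solution pair, with domain `E`, to the hybrid system `H`. -/
structure IsSolutionPair {X U : Type*} [NormedAddCommGroup X] [NormedSpace ℝ X]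
    [NormedAddCommGroup U] (H : HybridSystem X U) (E : Set (ℝ × ℕ))
    (φ : ℝ → ℕ → X) (u : ℝ → ℕ → U) : Prop where
  arc : IsHybridArc E φ
  input : IsHybridInput E u
  initial : φ 0 0 ∈ closure H.C ∪ H.D
  flow_mem : ∀ j, ∀ t ∈ interior (timeSlice E j), φ t j ∈ H.C
  flow : ∀ j, ∀ᵐ t ∂(volume.restrict (timeSlice E j)),
    HasDerivAt (fun s => φ s j) (H.f (φ t j) (u t j)) t
  jump : ∀ t j, (t, j) ∈ jumpPoints E → φ t j ∈ H.D ∧ φ t (j + 1) ∈ H.G (φ t j) (u t j)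

/-- Input-to-state stability of `H` with respect to the set `A`. For inputs with `|u|_∞ = ∞` the
estimate carries no information and is not required. -/
def IsISS {X U : Type*} [NormedAddCommGroup X] [NormedSpace ℝ X] [NormedAddCommGroup U]
    (H : HybridSystem X U) (A : Set X) : Prop :=
  ∃ β : ℝ → ℝ → ℝ, ∃ κ : ℝ → ℝ, IsClassKL β ∧ IsClassK κ ∧
    ∀ (E : Set (ℝ × ℕ)) (φ : ℝ → ℕ → X) (u : ℝ → ℕ → U),
      IsSolutionPair H E φ u → inputNorm E u < ⊤ →
      ∀ t j, (t, j) ∈ E →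
        Metric.infDist (φ t j) A ≤
          max (β (Metric.infDist (φ 0 0) A) (t + j)) (κ (inputNorm E u).toReal)

/-! ## Digraphs -/

/-- Any two nodes are joined by a directed path. -/
def IsStronglyConnected {V : Type*} (𝒢 : Digraph V) : Prop :=
  ∀ i j, Relation.ReflTransGen 𝒢.Adj i j

open scoped Classical in
/-- `inAdj i k = 1` if `k` is an in-neighbour of `i`, i.e. if there is an edge `(k,i)`. -/
def inAdj {V : Type*} (𝒢 : Digraph V) : Matrix V V ℝ :=
  of fun i k => if 𝒢.Adj k i then 1 else 0

/-- The Laplacian: `(ℒ e)_i = ∑_{k ∈ 𝒩(i)} (e_i - e_k)`, `𝒩(i)` being the in-neighbours of `i`. -/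
def laplacian {V : Type*} [Fintype V] [DecidableEq V] (𝒢 : Digraph V) : Matrix V V ℝ :=
  diagonal (fun i => ∑ k, inAdj 𝒢 i k) - inAdj 𝒢

/-- The block matrix `[0 0; 0 M]` of size `m + 1`. -/
def zeroBlock {m : ℕ} (M : Matrix (Fin m) (Fin m) ℝ) : Matrix (Fin (m + 1)) (Fin (m + 1)) ℝ :=
  of fun i j => Fin.cases 0 (fun i' => Fin.cases 0 (fun j' => M i' j') j) i

/-- `𝒯 = [v₁, 𝒯₁]` is nonsingular with `v₁ = (1/√N) 𝟏_N`, where `N = m + 1`, and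
`𝒯⁻¹ ℒ 𝒯 = [0 0; 0 ℒbar]`. -/
structure IsLaplacianTransform {m : ℕ} (L : Matrix (Fin (m + 1)) (Fin (m + 1)) ℝ)
    (𝒯 : Matrix (Fin (m + 1)) (Fin (m + 1)) ℝ) (Lbar : Matrix (Fin m) (Fin m) ℝ) : Prop where
  nonsingular : IsUnit 𝒯.det
  firstColumn : ∀ i, 𝒯 i 0 = 1 / Real.sqrt ((m : ℝ) + 1)
  conj_eq : 𝒯⁻¹ * L * 𝒯 = zeroBlock Lbar

/-! ## The matrices of the model (`m = N - 1`) -/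

/-- Index type of the vectors in `ℝ^{2m}`, seen as pairs of vectors in `ℝ^m`. -/
abbrev Blk (m : ℕ) : Type := Fin m ⊕ Fin m

def Af1 (h : ℝ) : Matrix (Fin 2) (Fin 2) ℝ := !![0, 1; 0, h]
def Af2 (m : ℕ) (h : ℝ) : Matrix (Blk m) (Blk m) ℝ := fromBlocks 0 1 0 (h • 1)
def Af3 (μ : ℝ) : Matrix (Fin 2) (Fin 2) ℝ := !![0, μ; -1, -1]
def Af4 (m : ℕ) (μ : ℝ) : Matrix (Blk m) (Blk m) ℝ := fromBlocks 0 (μ • 1) (-1) (-1)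
def Bf1 : Matrix (Fin 2) (Fin 2) ℝ := !![1, 0; 0, 0]
def Bf2 (m : ℕ) : Matrix (Blk m) (Blk m) ℝ := fromBlocks 1 0 0 0
def Ag1 : Matrix (Fin 2) (Fin 2) ℝ := !![1, 0; 0, 0]
def Ag2 {m : ℕ} (γ : ℝ) (Lbar : Matrix (Fin m) (Fin m) ℝ) : Matrix (Blk m) (Blk m) ℝ :=
  fromBlocks 1 0 (-γ • Lbar) 0

/-! ## State space -/

/-- Index type of the state `χ = (z₁, z₂, w₁, w₂, τ) ∈ ℝ² × ℝ^{2m} × ℝ² × ℝ^{2m} × ℝ`. -/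
abbrev StateIdx (m : ℕ) : Type := Fin 2 ⊕ Blk m ⊕ Fin 2 ⊕ Blk m ⊕ Unit

/-- The state space with its Euclidean norm. -/
abbrev State (m : ℕ) : Type := EuclideanSpace ℝ (StateIdx m)

def z1 {m : ℕ} (χ : State m) : Fin 2 → ℝ := fun i => χ (.inl i)
def z2 {m : ℕ} (χ : State m) : Blk m → ℝ := fun i => χ (.inr (.inl i))
def w1 {m : ℕ} (χ : State m) : Fin 2 → ℝ := fun i => χ (.inr (.inr (.inl i)))
def w2 {m : ℕ} (χ : State m) : Blk m → ℝ := fun i => χ (.inr (.inr (.inr (.inl i))))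
def timer {m : ℕ} (χ : State m) : ℝ := χ (.inr (.inr (.inr (.inr ()))))

/-- The state with the given components. -/
def mkState {m : ℕ} (a : Fin 2 → ℝ) (b : Blk m → ℝ) (c : Fin 2 → ℝ) (d : Blk m → ℝ) (τ : ℝ) :
    State m :=
  WithLp.toLp 2 (Sum.elim a (Sum.elim b (Sum.elim c (Sum.elim d (fun _ => τ)))))

/-- `𝒳_ε = ℝ² × ℝ^{2m} × ℝ² × ℝ^{2m} × [0,T₂]`. -/
def stateSet (m : ℕ) (T₂ : ℝ) : Set (State m) := {χ | timer χ ∈ Icc 0 T₂}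

/-- The target set: `z₁ = (e*, 0)` with `e* ∈ ℝ`, `z₂ = 0`, `w₁ = 0`, `w₂ = 0`. -/
def targetSet (m : ℕ) (T₂ : ℝ) : Set (State m) :=
  {χ | χ ∈ stateSet m T₂ ∧ (∃ e : ℝ, z1 χ = ![e, 0]) ∧ z2 χ = 0 ∧ w1 χ = 0 ∧ w2 χ = 0}

/-- The perturbed hybrid system. The input `σ = (σ₁, σ₂) ∈ ℝ × ℝ^m` is the transformed error
on the clock-rate reference; it acts on the derivative of `(ē₁, (ē₂, …, ē_N))`. -/
def sigmaSystem {m : ℕ} (T₁ T₂ μ h γ : ℝ) (Lbar : Matrix (Fin m) (Fin m) ℝ) :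
    HybridSystem (State m) (EuclideanSpace ℝ (Fin (m + 1))) where
  C := stateSet m T₂
  f χ σ := mkState
    (Af1 h *ᵥ z1 χ + Bf1 *ᵥ w1 χ + ![σ 0, 0])
    (Af2 m h *ᵥ z2 χ + Bf2 m *ᵥ w2 χ + Sum.elim (fun i => σ (Fin.succ i)) (fun _ => 0))
    (Af3 μ *ᵥ w1 χ)
    (Af4 m μ *ᵥ w2 χ)
    (-1)
  D := {χ | χ ∈ stateSet m T₂ ∧ timer χ = 0}
  G χ _ := {g | ∃ ν ∈ Icc T₁ T₂,
    g = mkState (Ag1 *ᵥ z1 χ) (Ag2 γ Lbar *ᵥ z2 χ) (w1 χ) (w2 χ) ν}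

/-! ## The constants of the stability condition -/

/-- Largest eigenvalue of a (symmetric) matrix. -/
def lamMax {ι : Type*} [Fintype ι] [DecidableEq ι] (A : Matrix ι ι ℝ) : ℝ := sSup (spectrum ℝ A)

/-- Smallest eigenvalue of a (symmetric) matrix. -/
def lamMin {ι : Type*} [Fintype ι] [DecidableEq ι] (A : Matrix ι ι ℝ) : ℝ := sInf (spectrum ℝ A)

/-- `|A| = max {√|λ| : λ ∈ eig(AᵀA)}`. -/
def matNorm {ι : Type*} [Fintype ι] [DecidableEq ι] (A : Matrix ι ι ℝ) : ℝ :=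
  sSup ((fun l => Real.sqrt |l|) '' spectrum ℝ (Aᵀ * A))

/-- `exp(A_{f₂}ᵀ ν) P₁ exp(A_{f₂} ν)`. -/
def expConj {m : ℕ} (h : ℝ) (P₁ : Matrix (Blk m) (Blk m) ℝ) (ν : ℝ) : Matrix (Blk m) (Blk m) ℝ :=
  NormedSpace.exp (ν • (Af2 m h)ᵀ) * P₁ * NormedSpace.exp (ν • Af2 m h)

/-- `A_{g₂}ᵀ exp(A_{f₂}ᵀ ν) P₁ exp(A_{f₂} ν) A_{g₂} - P₁`. -/
def jumpForm {m : ℕ} (h γ : ℝ) (Lbar : Matrix (Fin m) (Fin m) ℝ) (P₁ : Matrix (Blk m) (Blk m) ℝ)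
    (ν : ℝ) : Matrix (Blk m) (Blk m) ℝ :=
  (Ag2 γ Lbar)ᵀ * expConj h P₁ ν * Ag2 γ Lbar - P₁

/-- `κ₁ = 2 max_{ν ∈ [0,T₂]} |exp(A_{f₂}ᵀ ν) P₁ exp(A_{f₂} ν)|`. -/
def kappa1 {m : ℕ} (T₂ h : ℝ) (P₁ : Matrix (Blk m) (Blk m) ℝ) : ℝ :=
  2 * sSup ((fun ν => matNorm (expConj h P₁ ν)) '' Icc 0 T₂)

/-- `α₂ = max_{ν ∈ [0,T₂]} {exp(2hν), λ_max(exp(A_{f₂}ᵀ ν) P₁ exp(A_{f₂} ν)), λ_max(P₂),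
λ_max(P₃)}`. -/
def alpha2 {m : ℕ} (T₂ h : ℝ) (P₁ : Matrix (Blk m) (Blk m) ℝ) (P₂ : Matrix (Fin 2) (Fin 2) ℝ)
    (P₃ : Matrix (Blk m) (Blk m) ℝ) : ℝ :=
  sSup ((fun ν => max (max (Real.exp (2 * h * ν)) (lamMax (expConj h P₁ ν)))
    (max (lamMax P₂) (lamMax P₃))) '' Icc 0 T₂)

/-- Supremum of the admissible `κ₂`: `- min_{ν ∈ [T₁,T₂]} λ_min(jumpForm ν)`. -/
def kappa2Bound {m : ℕ} (T₁ T₂ h γ : ℝ) (Lbar : Matrix (Fin m) (Fin m) ℝ)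
    (P₁ : Matrix (Blk m) (Blk m) ℝ) : ℝ :=
  -sInf ((fun ν => lamMin (jumpForm h γ Lbar P₁ ν)) '' Icc T₁ T₂)

/-- `κ̄₁ = max {κ₁/(2ϵ), κ₁ϵ/2 - β₂}`. -/
def kappaBar1 {m : ℕ} (T₂ h : ℝ) (P₁ : Matrix (Blk m) (Blk m) ℝ) (ϵ β₂ : ℝ) : ℝ :=
  max (kappa1 T₂ h P₁ / (2 * ϵ)) (kappa1 T₂ h P₁ * ϵ / 2 - β₂)

end

end HyNTP

open HyNTP

namespace HyNTP

/-! ## Induction along hybrid time domains -/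

/-! On the state set the squared distance to the target is `distSq`: the first entry of `z1` is free
there, and `w1` and `σ 0` enter only the derivative of that entry. What remains is a cascade: `w1`
and `w2` decay autonomously, the second entry η of `z1` is unforced, and `z2` is driven by `w2` and
the input.

The function `lyap` exploits this. Since the timer runs at rate -1, transporting η and `z2` by the
flow over the remaining time τ cancels their own drift: `exp(hτ) η` is constant along flows, and
`exp(τ A) z2`, with A = `Af2 m h`, moves only under the forcing. The factor `exp(λτ)` then gives
strict decrease during flows. It is affordable because the jump condition, uniform on a compact
interval, provides a contraction by 1 - δ, while the factor is reset to at most 1 + δ. A large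
weight `K` on the `w2` part absorbs the coupling from `w2` into `z2` (Young's inequality). So `V' ≤
-cV + C|σ|²` along flows and `V` does not increase at jumps (`isISS_sigmaSystem`).

Integrating along absolutely continuous arcs gives decay in ordinary time t
(`IsSolutionPair.lyapunov_le`). Successive jumps are separated enough that j is bounded affinely by
t (`IsSolutionPair.jump_count_le`), which turns this into decay in t + j
(`isISS_of_quadratic_lyapunov`). -/

theorem IsHybridTimeDomain.induction {E : Set (ℝ × ℕ)} (hE : IsHybridTimeDomain E)
    {P : ℝ → ℕ → Prop} (h0 : P 0 0)
    (hflow : ∀ j a b, a ≤ b → Icc a b ⊆ timeSlice E j → P a j → P b j)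
    (hjump : ∀ t j, (t, j) ∈ jumpPoints E → P t j → P t (j + 1)) :
    ∀ t j, (t, j) ∈ E → P t j := by
  intro T J hTJ
  obtain ⟨s, hs0, hmono, heq⟩ := hE.truncation T J hTJ
  have hmem : ∀ j ≤ J, ∀ t ∈ Icc (s j) (s (j + 1)), (t, j) ∈ E := by
    intro j hj t ht
    have : (t, j) ∈ E ∩ (Icc 0 T ×ˢ Iic J) := by rw [heq]; exact ⟨hj, ht⟩
    exact this.1
  have hstep : ∀ j ≤ J, P (s j) j → ∀ t ∈ Icc (s j) (s (j + 1)), P t j := by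
    intro j hj hP t ht
    refine hflow j (s j) t ht.1 ?_ hP
    intro r hr
    exact hmem j hj r ⟨hr.1, hr.2.trans ht.2⟩
  -- Truncation at `(T, J)` leaves finitely many flow intervals chained by jumps, so ordinary
  -- induction over their left endpoints suffices.
  have hstart : ∀ j ≤ J, P (s j) j := by
    intro j
    induction j with
    | zero => intro _; rw [hs0]; exact h0
    | succ j ih =>
      intro hj
      have hj' : j ≤ J := by omega
      refine hjump _ _ ⟨hmem j hj' _ ⟨hmono j hj', le_rfl⟩, ?_⟩
        (hstep j hj' (ih hj') _ ⟨hmono j hj', le_rfl⟩)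
      exact hmem (j + 1) hj _ ⟨le_rfl, hmono _ hj⟩
  have hmemT : (T, J) ∈ E ∩ (Icc 0 T ×ˢ Iic J) :=
    ⟨hTJ, ⟨hE.nonneg _ hTJ, le_rfl⟩, mem_Iic.2 le_rfl⟩
  rw [heq] at hmemT
  exact hstep J le_rfl (hstart J le_rfl) T hmemT.2

/-! ## Absolutely continuous functions -/

theorem _root_.LipschitzOnWith.comp_absolutelyContinuousOnInterval {X Y : Type*}
    [PseudoMetricSpace X] [PseudoMetricSpace Y] {g : X → Y} {K : NNReal} {s : Set X}
    (hg : LipschitzOnWith K g s) {f : ℝ → X} {a b : ℝ}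
    (hf : AbsolutelyContinuousOnInterval f a b) (hfs : MapsTo f (uIcc a b) s) :
    AbsolutelyContinuousOnInterval (g ∘ f) a b := by
  rw [absolutelyContinuousOnInterval_iff] at hf ⊢
  intro ε hε
  -- `K + 1` rather than `K`, since the Lipschitz constant may vanish.
  obtain ⟨δ, hδ, H⟩ := hf (ε / (K + 1)) (by positivity)
  refine ⟨δ, hδ, fun I hI hlt => ?_⟩
  have h1 := H I hI hlt
  calc ∑ i ∈ Finset.range I.1, dist ((g ∘ f) (I.2 i).1) ((g ∘ f) (I.2 i).2)
      ≤ ∑ i ∈ Finset.range I.1, K * dist (f (I.2 i).1) (f (I.2 i).2) := by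
        refine Finset.sum_le_sum fun i hi => ?_
        exact hg.dist_le_mul _ (hfs (hI.1 i hi).1) _ (hfs (hI.1 i hi).2)
    _ = K * ∑ i ∈ Finset.range I.1, dist (f (I.2 i).1) (f (I.2 i).2) := by
        rw [Finset.mul_sum]
    _ ≤ (K + 1) * ∑ i ∈ Finset.range I.1, dist (f (I.2 i).1) (f (I.2 i).2) := by
        gcongr
        simp
    _ < (K + 1) * (ε / (K + 1)) := by gcongr
    _ = ε := by field_simp

/-- A C¹ function need not be globally Lipschitz, but it is Lipschitz on the compact image of the
arc. This is what makes a quadratic Lyapunov function absolutely continuous along solutions. -/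
theorem _root_.ContDiff.comp_absolutelyContinuousOnInterval {X Y : Type*}
    [NormedAddCommGroup X] [NormedSpace ℝ X] [NormedAddCommGroup Y] [NormedSpace ℝ Y]
    {g : X → Y} (hg : ContDiff ℝ 1 g) {f : ℝ → X} {a b : ℝ}
    (hf : AbsolutelyContinuousOnInterval f a b) :
    AbsolutelyContinuousOnInterval (g ∘ f) a b := by
  have hc : IsCompact (f '' uIcc a b) := isCompact_uIcc.image_of_continuousOn hf.continuousOn
  obtain ⟨K, hK⟩ := LocallyLipschitzOn.exists_lipschitzOnWith_of_compact hc
    (hg.locallyLipschitz.locallyLipschitzOn)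
  exact hK.comp_absolutelyContinuousOnInterval hf (mapsTo_image _ _)

/-- The fundamental theorem of calculus for absolutely continuous functions replaces the mean value
theorem: solutions satisfy the flow equation only almost everywhere. -/
theorem _root_.AbsolutelyContinuousOnInterval.le_of_ae_hasDerivAt_nonpos {f : ℝ → ℝ} {a b : ℝ}
    (hab : a ≤ b) (hf : AbsolutelyContinuousOnInterval f a b)
    (hd : ∀ᵐ t ∂(volume.restrict (Icc a b)), ∃ d ≤ 0, HasDerivAt f d t) : f b ≤ f a := by
  have h1 := hf.integral_deriv_eq_sub
  have h2 : ∫ x in a..b, deriv f x ≤ 0 := by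
    rw [intervalIntegral.integral_of_le hab]
    refine integral_nonpos_of_ae ?_
    have := ae_restrict_of_ae_restrict_of_subset (Ioc_subset_Icc_self (a := a) (b := b)) hd
    filter_upwards [this] with x hx
    obtain ⟨d, hd0, hd⟩ := hx
    simpa [hd.deriv] using hd0
  linarith

/-! ## Quadratic forms -/

/-- The quadratic form `x ↦ xᵀ M x`. -/
def quad {ι : Type*} [Fintype ι] (M : Matrix ι ι ℝ) (x : ι → ℝ) : ℝ := x ⬝ᵥ M *ᵥ x

section quad

variable {ι : Type*} [Fintype ι]

theorem quad_smul (M : Matrix ι ι ℝ) (r : ℝ) (x : ι → ℝ) : quad M (r • x) = r ^ 2 * quad M x := by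
  simp [quad, mulVec_smul]; ring

theorem quad_mulVec (M N : Matrix ι ι ℝ) (x : ι → ℝ) : quad M (N *ᵥ x) = quad (Nᵀ * M * N) x := by
  simp only [quad]
  rw [← mulVec_mulVec, ← mulVec_mulVec, dotProduct_mulVec x Nᵀ, vecMul_transpose]

theorem quad_sub (M N : Matrix ι ι ℝ) (x : ι → ℝ) : quad (M - N) x = quad M x - quad N x := by
  simp [quad, sub_mulVec]

theorem quad_neg (M : Matrix ι ι ℝ) (x : ι → ℝ) : quad (-M) x = - quad M x := by
  simp [quad, neg_mulVec]

theorem quad_pos {M : Matrix ι ι ℝ} (hM : M.PosDef) {x : ι → ℝ} (hx : x ≠ 0) : 0 < quad M x := by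
  simpa [quad] using hM.dotProduct_mulVec_pos hx

theorem quad_nonneg {M : Matrix ι ι ℝ} (hM : M.PosSemidef) (x : ι → ℝ) : 0 ≤ quad M x := by
  simpa [quad] using hM.dotProduct_mulVec_nonneg x

theorem dotProduct_mulVec_comm_of_isHermitian {M : Matrix ι ι ℝ} (hM : M.IsHermitian)
    (x y : ι → ℝ) : x ⬝ᵥ M *ᵥ y = y ⬝ᵥ M *ᵥ x := by
  have hT : Mᵀ = M := by simpa [IsHermitian, conjTranspose_eq_transpose_of_trivial] using hM
  rw [dotProduct_mulVec, ← mulVec_transpose, hT, dotProduct_comm]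

/-- Young's inequality for a positive semidefinite form. -/
theorem two_mul_dotProduct_mulVec_le {M : Matrix ι ι ℝ} (hM : M.PosSemidef) {r : ℝ} (hr : 0 < r)
    (x y : ι → ℝ) : 2 * (x ⬝ᵥ M *ᵥ y) ≤ r * quad M x + r⁻¹ * quad M y := by
  have h := quad_nonneg hM (r • x - y)
  have hsym := dotProduct_mulVec_comm_of_isHermitian hM.1 x y
  have he : quad M (r • x - y) = r ^ 2 * quad M x - 2 * r * (x ⬝ᵥ M *ᵥ y) + quad M y := by
    simp only [quad, mulVec_sub, mulVec_smul, sub_dotProduct, dotProduct_sub, smul_dotProduct,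
      dotProduct_smul, smul_eq_mul, ← hsym]
    ring
  have h3 : 0 ≤ r⁻¹ * quad M (r • x - y) := by positivity
  rw [he] at h3
  have : r⁻¹ * (r ^ 2 * quad M x - 2 * r * (x ⬝ᵥ M *ᵥ y) + quad M y)
      = r * quad M x - 2 * (x ⬝ᵥ M *ᵥ y) + r⁻¹ * quad M y := by field_simp
  linarith

/-- The Euclidean sphere is written with the dot product because `ι → ℝ` carries the sup norm. -/
theorem isCompact_dotProduct_self_eq_one : IsCompact {x : ι → ℝ | x ⬝ᵥ x = 1} := by
  refine Metric.isCompact_of_isClosed_isBounded ?_ ?_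
  · exact isClosed_eq (by fun_prop) continuous_const
  · refine (Metric.isBounded_closedBall (x := (0 : ι → ℝ)) (r := 1)).subset fun x hx => ?_
    rw [mem_closedBall_zero_iff, pi_norm_le_iff_of_nonneg zero_le_one]
    intro i
    have h1 : x i * x i ≤ x ⬝ᵥ x :=
      Finset.single_le_sum (f := fun i => x i * x i) (fun i _ => mul_self_nonneg _)
        (Finset.mem_univ i)
    rw [Real.norm_eq_abs]
    have h2 : x ⬝ᵥ x = 1 := hx
    rw [h2] at h1
    exact abs_le_one_iff_mul_self_le_one.2 h1

theorem dotProduct_self_nonneg' (x : ι → ℝ) : 0 ≤ x ⬝ᵥ x :=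
  Finset.sum_nonneg fun i _ => mul_self_nonneg (x i)

theorem continuous_quad_uncurry : Continuous fun p : Matrix ι ι ℝ × (ι → ℝ) => quad p.1 p.2 := by
  unfold quad
  fun_prop

theorem exists_smul_dotProduct_self_eq_one {x : ι → ℝ} (hx : x ≠ 0) :
    ∃ r : ℝ, ∃ u : ι → ℝ, u ⬝ᵥ u = 1 ∧ x = r • u ∧ r ^ 2 = x ⬝ᵥ x := by
  have hpos : 0 < x ⬝ᵥ x := lt_of_le_of_ne (dotProduct_self_nonneg' x)
    (fun h => hx (dotProduct_self_eq_zero.1 h.symm))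
  have hs := Real.sqrt_pos.2 hpos
  refine ⟨√(x ⬝ᵥ x), (√(x ⬝ᵥ x))⁻¹ • x, ?_, ?_, Real.sq_sqrt hpos.le⟩
  · rw [smul_dotProduct, dotProduct_smul, smul_eq_mul, smul_eq_mul, ← mul_assoc, ← mul_inv,
      Real.mul_self_sqrt hpos.le, inv_mul_cancel₀ hpos.ne']
  · rw [smul_smul, mul_inv_cancel₀ hs.ne', one_smul]

/-- By homogeneity it is enough to bound the form on `K` times the unit sphere, a compact set on
which it is continuous and positive. This makes the constant uniform in `ν`. -/
theorem exists_pos_forall_le_quad {M : ℝ → Matrix ι ι ℝ} {K : Set ℝ} (hK : IsCompact K)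
    (hM : ContinuousOn M K) (hpos : ∀ ν ∈ K, (M ν).PosDef) :
    ∃ δ > 0, ∀ ν ∈ K, ∀ x, δ * (x ⬝ᵥ x) ≤ quad (M ν) x := by
  have hcont : ContinuousOn (fun p : ℝ × (ι → ℝ) => quad (M p.1) p.2)
      (K ×ˢ {x | x ⬝ᵥ x = 1}) :=
    continuous_quad_uncurry.comp_continuousOn
      ((hM.comp continuousOn_fst fun p hp => hp.1).prodMk continuousOn_snd)
  obtain ⟨δ, hδ, H⟩ := (hK.prod isCompact_dotProduct_self_eq_one).exists_forall_le' hcont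
    (a := 0) (by
      rintro ⟨ν, x⟩ ⟨hν, hx⟩
      refine quad_pos (hpos ν hν) ?_
      rintro rfl
      simp at hx)
  refine ⟨δ, hδ, fun ν hν x => ?_⟩
  rcases eq_or_ne x 0 with rfl | hx
  · simp [quad]
  obtain ⟨r, u, hu, rfl, hr⟩ := exists_smul_dotProduct_self_eq_one hx
  rw [← hr, quad_smul, mul_comm]
  exact mul_le_mul_of_nonneg_left (H (ν, u) ⟨hν, hu⟩) (sq_nonneg r)

theorem exists_pos_forall_quad_le {M : ℝ → Matrix ι ι ℝ} {K : Set ℝ} (hK : IsCompact K)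
    (hM : ContinuousOn M K) :
    ∃ C > 0, ∀ ν ∈ K, ∀ x, quad (M ν) x ≤ C * (x ⬝ᵥ x) := by
  have hcont : ContinuousOn (fun p : ℝ × (ι → ℝ) => quad (M p.1) p.2)
      (K ×ˢ {x | x ⬝ᵥ x = 1}) :=
    continuous_quad_uncurry.comp_continuousOn
      ((hM.comp continuousOn_fst fun p hp => hp.1).prodMk continuousOn_snd)
  obtain ⟨C, H⟩ := (hK.prod isCompact_dotProduct_self_eq_one).exists_bound_of_continuousOn hcont
  -- The maximum with 1 keeps the constant positive when the compactness bound is not.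
  refine ⟨max C 1, by positivity, fun ν hν x => ?_⟩
  rcases eq_or_ne x 0 with rfl | hx
  · simp [quad]
  obtain ⟨r, u, hu, rfl, hr⟩ := exists_smul_dotProduct_self_eq_one hx
  rw [← hr, quad_smul, mul_comm (max C 1)]
  exact mul_le_mul_of_nonneg_left (((le_abs_self _).trans (H (ν, u) ⟨hν, hu⟩)).trans
    (le_max_left _ _)) (sq_nonneg r)

theorem hasDerivAt_quad {M : Matrix ι ι ℝ} (hM : M.IsHermitian) {x : ℝ → ι → ℝ} {x' : ι → ℝ}
    {t : ℝ} (hx : HasDerivAt x x' t) :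
    HasDerivAt (fun s => quad M (x s)) (2 * (x t ⬝ᵥ M *ᵥ x')) t := by
  have hx' := hasDerivAt_pi.1 hx
  have h1 : HasDerivAt (fun s => ∑ i, x s i * ∑ j, M i j * x s j)
      (∑ i, (x' i * ∑ j, M i j * x t j + x t i * ∑ j, M i j * x' j)) t := by
    refine HasDerivAt.fun_sum fun i _ => ?_
    refine (hx' i).mul ?_
    exact HasDerivAt.fun_sum fun j _ => (hx' j).const_mul _
  have h2 : 2 * (x t ⬝ᵥ M *ᵥ x') = x' ⬝ᵥ M *ᵥ x t + x t ⬝ᵥ M *ᵥ x' := by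
    rw [dotProduct_mulVec_comm_of_isHermitian hM x' (x t)]; ring
  rw [h2]
  simpa [quad, dotProduct, mulVec, Finset.sum_add_distrib] using h1

theorem contDiff_quad (M : Matrix ι ι ℝ) : ContDiff ℝ 1 (quad M) := by
  unfold quad dotProduct mulVec dotProduct
  fun_prop

variable [DecidableEq ι]

/-- Stated entrywise, so that the operator norm on matrices is needed only inside the proof. -/
theorem hasDerivAt_exp_smul_apply (A : Matrix ι ι ℝ) (t : ℝ) (i j : ι) :
    HasDerivAt (fun s : ℝ => NormedSpace.exp (s • A) i j)
      ((NormedSpace.exp (t • A) * A) i j) t := by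
  open scoped Matrix.Norms.Operator in
  have h := hasDerivAt_exp_smul_const (𝕂 := ℝ) A t
  exact hasDerivAt_pi.1 (hasDerivAt_pi.1 h i) j

theorem continuous_exp_smul (A : Matrix ι ι ℝ) :
    Continuous fun s : ℝ => NormedSpace.exp (s • A) :=
  continuous_matrix fun i j =>
    continuous_iff_continuousAt.2 fun t => (hasDerivAt_exp_smul_apply A t i j).continuousAt

theorem contDiff_exp_smul_apply (A : Matrix ι ι ℝ) (i j : ι) :
    ContDiff ℝ 1 fun s : ℝ => NormedSpace.exp (s • A) i j := by
  rw [contDiff_one_iff_deriv]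
  refine ⟨fun t => (hasDerivAt_exp_smul_apply A t i j).differentiableAt, ?_⟩
  have : deriv (fun s : ℝ => NormedSpace.exp (s • A) i j) =
      fun t => (NormedSpace.exp (t • A) * A) i j :=
    funext fun t => (hasDerivAt_exp_smul_apply A t i j).deriv
  rw [this]
  exact ((continuous_exp_smul A).matrix_mul continuous_const).matrix_elem i j

/-- The form of the derivative makes a cancellation visible: for `τ' = -1` and `x' = A x + v`, only
`exp(τ A) v` survives. -/
theorem hasDerivAt_exp_smul_mulVec (A : Matrix ι ι ℝ) {τ : ℝ → ℝ} {τ' t : ℝ} {x : ℝ → ι → ℝ}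
    {x' : ι → ℝ} (hτ : HasDerivAt τ τ' t) (hx : HasDerivAt x x' t) :
    HasDerivAt (fun s => NormedSpace.exp (τ s • A) *ᵥ x s)
      (NormedSpace.exp (τ t • A) *ᵥ (τ' • A *ᵥ x t + x')) t := by
  have hx' := hasDerivAt_pi.1 hx
  refine hasDerivAt_pi.2 fun i => ?_
  have h1 : HasDerivAt (fun s => ∑ j, NormedSpace.exp (τ s • A) i j * x s j)
      (∑ j, ((NormedSpace.exp (τ t • A) * A) i j * τ' * x t j
        + NormedSpace.exp (τ t • A) i j * x' j)) t := by
    refine HasDerivAt.fun_sum fun j _ => ?_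
    exact ((hasDerivAt_exp_smul_apply A (τ t) i j).comp t hτ).mul (hx' j)
  refine h1.congr_deriv ?_
  rw [Finset.sum_add_distrib, mulVec_add, mulVec_smul, mulVec_mulVec]
  simp only [Pi.add_apply, Pi.smul_apply, smul_eq_mul, mulVec, dotProduct, Finset.mul_sum]
  congr 1
  exact Finset.sum_congr rfl fun j _ => by ring

end quad

/-! ## Distance to the target set -/

section state

variable {m : ℕ}

/-- Squared distance to the target set, for states in the state set. -/
def distSq (χ : State m) : ℝ :=
  z1 χ 1 ^ 2 + z2 χ ⬝ᵥ z2 χ + w1 χ ⬝ᵥ w1 χ + w2 χ ⬝ᵥ w2 χ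

theorem distSq_nonneg (χ : State m) : 0 ≤ distSq χ := by
  have h1 := dotProduct_self_nonneg' (z2 χ)
  have h2 := dotProduct_self_nonneg' (w1 χ)
  have h3 := dotProduct_self_nonneg' (w2 χ)
  unfold distSq
  positivity

theorem dist_sq_eq (χ ψ : State m) :
    dist χ ψ ^ 2 = (z1 χ - z1 ψ) ⬝ᵥ (z1 χ - z1 ψ) + (z2 χ - z2 ψ) ⬝ᵥ (z2 χ - z2 ψ)
      + (w1 χ - w1 ψ) ⬝ᵥ (w1 χ - w1 ψ) + (w2 χ - w2 ψ) ⬝ᵥ (w2 χ - w2 ψ)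
      + (timer χ - timer ψ) ^ 2 := by
  rw [EuclideanSpace.dist_eq, Real.sq_sqrt (Finset.sum_nonneg fun i _ => sq_nonneg _)]
  simp only [Fintype.sum_sum_type, Real.dist_eq, sq_abs, dotProduct, Pi.sub_apply, z1, z2, w1, w2,
    timer, Finset.univ_unique, Finset.sum_singleton, ← pow_two]
  ring

theorem targetSet_nonempty {T₂ : ℝ} (hT : 0 ≤ T₂) : (targetSet m T₂).Nonempty := by
  refine ⟨0, ⟨le_rfl, hT⟩, ⟨0, ?_⟩, rfl, rfl, rfl⟩
  ext i
  fin_cases i <;> rfl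

theorem infDist_targetSet_le {T₂ : ℝ} {χ : State m} (hχ : χ ∈ stateSet m T₂) :
    Metric.infDist χ (targetSet m T₂) ≤ √(distSq χ) := by
  -- The nearest point of the target keeps the free entry of `z1` and the timer.
  have hmem : mkState ![z1 χ 0, 0] 0 0 0 (timer χ) ∈ targetSet m T₂ :=
    ⟨hχ, ⟨z1 χ 0, rfl⟩, rfl, rfl, rfl⟩
  refine (Metric.infDist_le_dist_of_mem hmem).trans (Real.le_sqrt_of_sq_le (le_of_eq ?_))
  rw [dist_sq_eq]
  have e1 : z1 (mkState (m := m) ![z1 χ 0, 0] 0 0 0 (timer χ)) = ![z1 χ 0, 0] := rfl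
  have e2 : z2 (mkState (m := m) ![z1 χ 0, 0] 0 0 0 (timer χ)) = 0 := rfl
  have e3 : w1 (mkState (m := m) ![z1 χ 0, 0] 0 0 0 (timer χ)) = 0 := rfl
  have e4 : w2 (mkState (m := m) ![z1 χ 0, 0] 0 0 0 (timer χ)) = 0 := rfl
  have e5 : timer (mkState (m := m) ![z1 χ 0, 0] 0 0 0 (timer χ)) = timer χ := rfl
  rw [e1, e2, e3, e4, e5, distSq]
  simp [dotProduct, Fin.sum_univ_two, pow_two]

theorem sqrt_distSq_le_infDist {T₂ : ℝ} (hT : 0 ≤ T₂) (χ : State m) :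
    √(distSq χ) ≤ Metric.infDist χ (targetSet m T₂) := by
  refine (Metric.le_infDist (targetSet_nonempty hT)).2 ?_
  rintro ψ ⟨-, ⟨e, he⟩, h2, h3, h4⟩
  refine Real.sqrt_le_iff.2 ⟨dist_nonneg, ?_⟩
  have hz : (z1 χ - ![e, 0]) ⬝ᵥ (z1 χ - ![e, 0]) = (z1 χ 0 - e) ^ 2 + z1 χ 1 ^ 2 := by
    simp [dotProduct, Fin.sum_univ_two, pow_two]
  rw [dist_sq_eq, he, h2, h3, h4, distSq, hz]
  simp only [sub_zero]
  nlinarith [sq_nonneg (z1 χ 0 - e), sq_nonneg (timer χ - timer ψ)]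

theorem distSq_le_infDist_sq {T₂ : ℝ} (hT : 0 ≤ T₂) (χ : State m) :
    distSq χ ≤ Metric.infDist χ (targetSet m T₂) ^ 2 :=
  (Real.sqrt_le_left Metric.infDist_nonneg).1 (sqrt_distSq_le_infDist hT χ)

end state

/-! ## The quadratic Lyapunov function -/

section lyap

variable {m : ℕ}

/-- A quadratic Lyapunov function for the planar subsystem `Af3 μ`. -/
def quadAf3 (μ : ℝ) (x : Fin 2 → ℝ) : ℝ :=
  (μ + 2) * x 0 ^ 2 + 2 * μ * (x 0 * x 1) + μ * (μ + 1) * x 1 ^ 2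

/-- A Lyapunov function for the nominal hybrid system, quadratic in the state for every value of
the timer. -/
noncomputable def lyap (h μ lam K : ℝ) (P₁ P₃ : Matrix (Blk m) (Blk m) ℝ) (χ : State m) : ℝ :=
  Real.exp (lam * timer χ) * ((Real.exp (h * timer χ) * z1 χ 1) ^ 2
    + quad P₁ (NormedSpace.exp (timer χ • Af2 m h) *ᵥ z2 χ))
  + K * quad P₃ (w2 χ) + quadAf3 μ (w1 χ)

theorem quad_exp_mulVec (h ν : ℝ) (P₁ : Matrix (Blk m) (Blk m) ℝ) (x : Blk m → ℝ) :
    quad P₁ (NormedSpace.exp (ν • Af2 m h) *ᵥ x) = quad (expConj h P₁ ν) x := by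
  rw [quad_mulVec, expConj, ← transpose_smul, exp_transpose]

theorem expConj_posDef {P₁ : Matrix (Blk m) (Blk m) ℝ} (hP₁ : P₁.PosDef) (h ν : ℝ) :
    (expConj h P₁ ν).PosDef := by
  rw [expConj, ← transpose_smul, exp_transpose, ← conjTranspose_eq_transpose_of_trivial]
  exact hP₁.conjTranspose_mul_mul_same
    (mulVec_injective_of_isUnit (Matrix.isUnit_exp _))

theorem continuous_expConj (h : ℝ) (P₁ : Matrix (Blk m) (Blk m) ℝ) :
    Continuous (expConj h P₁) :=
  ((continuous_exp_smul _).matrix_mul continuous_const).matrix_mul (continuous_exp_smul _)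

/-- Completing the square, the right-hand side equals `2 x₀² + μ² x₁²`. -/
theorem quadAf3_ge {μ : ℝ} (x : Fin 2 → ℝ) :
    min 2 (μ ^ 2) * (x ⬝ᵥ x) ≤ quadAf3 μ x - μ * (x 0 + x 1) ^ 2 := by
  simp only [dotProduct, Fin.sum_univ_two, quadAf3]
  nlinarith [mul_le_mul_of_nonneg_right (min_le_left 2 (μ ^ 2)) (sq_nonneg (x 0)),
    mul_le_mul_of_nonneg_right (min_le_right 2 (μ ^ 2)) (sq_nonneg (x 1))]

theorem quadAf3_le {μ : ℝ} (hμ : 0 < μ) (x : Fin 2 → ℝ) :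
    quadAf3 μ x ≤ (2 + 2 * μ + μ * (μ + 2)) * (x ⬝ᵥ x) := by
  simp only [dotProduct, Fin.sum_univ_two, quadAf3]
  nlinarith [mul_nonneg hμ.le (sq_nonneg (x 0 - x 1)), mul_nonneg hμ.le (sq_nonneg (x 0)),
    mul_nonneg hμ.le (sq_nonneg (x 1)), mul_nonneg (sq_nonneg μ) (sq_nonneg (x 0)), sq_nonneg (x 1)]

theorem contDiff_coord (i : StateIdx m) : ContDiff ℝ 1 fun χ : State m => χ i :=
  (EuclideanSpace.proj (𝕜 := ℝ) i).contDiff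

theorem contDiff_lyap (h μ lam K : ℝ) (P₁ P₃ : Matrix (Blk m) (Blk m) ℝ) :
    ContDiff ℝ 1 (lyap h μ lam K P₁ P₃) := by
  have hτ : ContDiff ℝ 1 fun χ : State m => timer χ := contDiff_coord _
  have hz1 : ∀ i, ContDiff ℝ 1 fun χ : State m => z1 χ i := fun i => contDiff_coord _
  have hz2 : ∀ i, ContDiff ℝ 1 fun χ : State m => z2 χ i := fun i => contDiff_coord _
  have hw1 : ∀ i, ContDiff ℝ 1 fun χ : State m => w1 χ i := fun i => contDiff_coord _
  have hw2 : ContDiff ℝ 1 fun χ : State m => w2 χ := contDiff_pi.2 fun i => contDiff_coord _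
  have hy : ContDiff ℝ 1 fun χ : State m => NormedSpace.exp (timer χ • Af2 m h) *ᵥ z2 χ := by
    refine contDiff_pi.2 fun i => ?_
    simp only [mulVec, dotProduct]
    exact ContDiff.sum fun j _ => ((contDiff_exp_smul_apply _ i j).comp hτ).mul (hz2 j)
  have hq1 := (contDiff_quad P₁).comp hy
  have hq3 := (contDiff_quad P₃).comp hw2
  have h10 := hw1 0
  have h11 := hw1 1
  have hz := hz1 1
  unfold lyap quadAf3
  simp only [Function.comp_def] at hq1 hq3
  exact (((contDiff_const.mul hτ).exp.mul (((((contDiff_const.mul hτ).exp.mul hz)).pow 2).add hq1)).add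
    (contDiff_const.mul hq3)).add (by fun_prop)

/-- The term `-lam * (...)` comes only from the timer in the exponential weight. The coefficients of
`quadAf3` are chosen so that mixed terms cancel and its derivative is exactly `-2μ|w1|²`. -/
theorem hasDerivAt_lyap {h μ lam K : ℝ} {P₁ P₃ : Matrix (Blk m) (Blk m) ℝ} (hP₁ : P₁.PosDef)
    (hP₃ : P₃.PosDef) {φ : ℝ → State m} {t T₁ T₂ γ : ℝ} {Lbar : Matrix (Fin m) (Fin m) ℝ}
    {σ : EuclideanSpace ℝ (Fin (m + 1))}
    (hφ : HasDerivAt φ ((sigmaSystem T₁ T₂ μ h γ Lbar).f (φ t) σ) t) :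
    HasDerivAt (fun s => lyap h μ lam K P₁ P₃ (φ s))
      (Real.exp (lam * timer (φ t)) * (-lam * ((Real.exp (h * timer (φ t)) * z1 (φ t) 1) ^ 2
          + quad P₁ (NormedSpace.exp (timer (φ t) • Af2 m h) *ᵥ z2 (φ t)))
        + 2 * ((NormedSpace.exp (timer (φ t) • Af2 m h) *ᵥ z2 (φ t)) ⬝ᵥ P₁ *ᵥ
          (NormedSpace.exp (timer (φ t) • Af2 m h) *ᵥ
            (Bf2 m *ᵥ w2 (φ t) + Sum.elim (fun i => σ (Fin.succ i)) (fun _ => 0)))))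
      + K * (2 * (w2 (φ t) ⬝ᵥ P₃ *ᵥ (Af4 m μ *ᵥ w2 (φ t))))
      - 2 * μ * (w1 (φ t) ⬝ᵥ w1 (φ t))) t := by
  have hc : ∀ i, HasDerivAt (fun s => φ s i) ((sigmaSystem T₁ T₂ μ h γ Lbar).f (φ t) σ i) t :=
    fun i => (EuclideanSpace.proj (𝕜 := ℝ) i).hasFDerivAt.comp_hasDerivAt t hφ
  have hτ : HasDerivAt (fun s => timer (φ s)) (-1) t := hc _
  have hη : HasDerivAt (fun s => z1 (φ s) 1) (h * z1 (φ t) 1) t := by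
    refine (hc (.inl 1)).congr_deriv ?_
    simp [sigmaSystem, mkState, Af1, Bf1, dotProduct, Fin.sum_univ_two]
  have hz2 : HasDerivAt (fun s => z2 (φ s)) (Af2 m h *ᵥ z2 (φ t) + Bf2 m *ᵥ w2 (φ t)
      + Sum.elim (fun i => σ (Fin.succ i)) (fun _ => 0)) t :=
    hasDerivAt_pi.2 fun i => hc (.inr (.inl i))
  have hw1 : ∀ i, HasDerivAt (fun s => w1 (φ s) i) ((Af3 μ *ᵥ w1 (φ t)) i) t :=
    fun i => hc (.inr (.inr (.inl i)))
  have hw2 : HasDerivAt (fun s => w2 (φ s)) (Af4 m μ *ᵥ w2 (φ t)) t :=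
    hasDerivAt_pi.2 fun i => hc (.inr (.inr (.inr (.inl i))))
  have ha : HasDerivAt (fun s => w1 (φ s) 0) (μ * w1 (φ t) 1) t :=
    (hw1 0).congr_deriv (by simp [Af3, mulVec, dotProduct, Fin.sum_univ_two])
  have hb : HasDerivAt (fun s => w1 (φ s) 1) (-w1 (φ t) 0 - w1 (φ t) 1) t :=
    (hw1 1).congr_deriv (by simp [Af3, mulVec, dotProduct, Fin.sum_univ_two]; ring)
  have hy := hasDerivAt_exp_smul_mulVec (Af2 m h) hτ hz2
  have hq1 := hasDerivAt_quad hP₁.1 hy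
  have hq3 := hasDerivAt_quad hP₃.1 hw2
  have he := (hτ.const_mul lam).exp
  have hη2 := ((hτ.const_mul h).exp.mul hη).pow 2
  have hU := (((ha.pow 2).const_mul (μ + 2)).add ((ha.mul hb).const_mul (2 * μ))).add
    ((hb.pow 2).const_mul (μ * (μ + 1)))
  have := ((he.mul (hη2.add hq1)).add (hq3.const_mul K)).add hU
  refine this.congr_deriv ?_
  have hv : (-1 : ℝ) • Af2 m h *ᵥ z2 (φ t) + (Af2 m h *ᵥ z2 (φ t) + Bf2 m *ᵥ w2 (φ t)
      + Sum.elim (fun i => σ (Fin.succ i)) (fun _ => 0)) =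
      Bf2 m *ᵥ w2 (φ t) + Sum.elim (fun i => σ (Fin.succ i)) (fun _ => 0) := by
    rw [neg_one_smul]; abel
  rw [hv]
  have hw : w1 (φ t) ⬝ᵥ w1 (φ t) = w1 (φ t) 0 ^ 2 + w1 (φ t) 1 ^ 2 := by
    simp [dotProduct, Fin.sum_univ_two, pow_two]
  rw [hw]
  simp only [Pi.add_apply, Pi.mul_apply, Pi.pow_apply]
  ring

end lyap

/-! ## Input-to-state stability from a quadratic Lyapunov function -/

theorem isClassKL_mul_exp_neg {A k : ℝ} (hA : 0 < A) (hk : 0 < k) :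
    IsClassKL fun r s => A * Real.exp (-(k * s)) * r where
  continuousOn := by fun_prop
  classK s _ :=
    { continuousOn := by fun_prop
      strictMonoOn := fun x _ y _ hxy => mul_lt_mul_of_pos_left hxy (by positivity)
      map_zero := by simp }
  antitoneOn r hr x _ y _ hxy := by
    have : Real.exp (-(k * y)) ≤ Real.exp (-(k * x)) :=
      Real.exp_le_exp.2 (neg_le_neg (mul_le_mul_of_nonneg_left hxy hk.le))
    exact mul_le_mul_of_nonneg_right (mul_le_mul_of_nonneg_left this hA.le) hr
  tendsto_zero r _ := by
    have h1 : Tendsto (fun s : ℝ => Real.exp (-(k * s))) atTop (𝓝 0) :=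
      Real.tendsto_exp_neg_atTop_nhds_zero.comp (tendsto_id.const_mul_atTop hk)
    simpa using (h1.const_mul A).mul_const r

theorem isClassK_const_mul {B : ℝ} (hB : 0 < B) : IsClassK fun r => B * r where
  continuousOn := by fun_prop
  strictMonoOn := fun x _ y _ hxy => mul_lt_mul_of_pos_left hxy hB
  map_zero := by simp

theorem ae_norm_le_inputNorm {U : Type*} [NormedAddCommGroup U] {E : Set (ℝ × ℕ)}
    {u : ℝ → ℕ → U} (hu : inputNorm E u < ⊤) (j : ℕ) :
    ∀ᵐ t ∂(volume.restrict (timeSlice E j)), ‖u t j‖ ≤ (inputNorm E u).toReal := by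
  have h1 : ∀ᵐ t ∂(volume.restrict (timeSlice E j)), ‖u t j‖ₑ ≤
      eLpNormEssSup (fun t => u t j) (volume.restrict (timeSlice E j)) :=
    enorm_ae_le_eLpNormEssSup _ _
  filter_upwards [h1] with t ht
  have h2 : ‖u t j‖ₑ ≤ inputNorm E u := by
    refine ht.trans ?_
    rw [← eLpNorm_exponent_top]
    exact (le_iSup (fun j => eLpNorm (fun t => u t j) ⊤ (volume.restrict (timeSlice E j))) j).trans
      (le_max_left _ _)
  simpa using ENNReal.toReal_mono hu.ne h2

/-- Passes from a sum estimate to the max form of input-to-state stability; the price is the factor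
2 under the square roots in the gains. -/
theorem le_max_of_sq_le_add_sq {d x y : ℝ} (hx : 0 ≤ x) (hy : 0 ≤ y)
    (h : 2 * d ^ 2 ≤ x ^ 2 + y ^ 2) : d ≤ max x y := by
  by_contra! hlt
  obtain ⟨h1, h2⟩ := max_lt_iff.1 hlt
  nlinarith

section solutions

variable {m : ℕ} {T₁ T₂ μ h γ : ℝ} {Lbar : Matrix (Fin m) (Fin m) ℝ} {E : Set (ℝ × ℕ)}
  {φ : ℝ → ℕ → State m} {u : ℝ → ℕ → EuclideanSpace ℝ (Fin (m + 1))}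

theorem continuous_timer : Continuous fun χ : State m => timer χ :=
  (contDiff_coord _).continuous

theorem isClosed_stateSet : IsClosed (stateSet m T₂) :=
  isClosed_Icc.preimage continuous_timer

/-- The solution concept puts the arc in the flow set only on the interior of each flow interval;
closedness and continuity carry this to the right endpoint. -/
theorem IsSolutionPair.mem_stateSet (hT₁ : 0 < T₁)
    (hs : IsSolutionPair (sigmaSystem T₁ T₂ μ h γ Lbar) E φ u) :
    ∀ t j, (t, j) ∈ E → φ t j ∈ stateSet m T₂ := by
  refine hs.arc.domain.induction (P := fun t j => φ t j ∈ stateSet m T₂) ?_ ?_ ?_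
  · rcases hs.initial with h0 | h0
    · rwa [show (sigmaSystem T₁ T₂ μ h γ Lbar).C = stateSet m T₂ from rfl,
        isClosed_stateSet.closure_eq] at h0
    · exact h0.1
  · intro j a b hab hsub ha
    rcases hab.eq_or_lt with rfl | hlt
    · exact ha
    have hc : ContinuousOn (fun t => φ t j) (Icc a b) := by
      have := (hs.arc.locallyAbsolutelyContinuous j a b hab hsub).continuousOn
      rwa [uIcc_of_le hab] at this
    have hint : Ioo a b ⊆ interior (timeSlice E j) :=
      interior_maximal (Ioo_subset_Icc_self.trans hsub) isOpen_Ioo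
    have hmaps : MapsTo (fun t => φ t j) (Ioo a b) (stateSet m T₂) :=
      fun t ht => hs.flow_mem j t (hint ht)
    have hb : b ∈ closure (Ioo a b) := by
      rw [closure_Ioo hlt.ne]; exact ⟨hab, le_rfl⟩
    have := ((hc b ⟨hab, le_rfl⟩).mono Ioo_subset_Icc_self).mem_closure hb hmaps
    rwa [isClosed_stateSet.closure_eq] at this
  · intro t j hj _
    obtain ⟨-, ν, hν, hg⟩ := hs.jump t j hj
    rw [hg]
    exact ⟨hT₁.le.trans hν.1, hν.2⟩

/-- Along flows `t + timer` is constant, and each jump raises it from `t` by at least `T₁`. -/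
theorem IsSolutionPair.jump_count_le
    (hs : IsSolutionPair (sigmaSystem T₁ T₂ μ h γ Lbar) E φ u) (h0 : 0 ≤ timer (φ 0 0)) :
    ∀ t j, (t, j) ∈ E → j * T₁ ≤ t + timer (φ t j) := by
  refine hs.arc.domain.induction (P := fun t j => j * T₁ ≤ t + timer (φ t j)) (by simpa using h0)
    ?_ ?_
  · intro j a b hab hsub ha
    have hac := (contDiff_coord (m := m) (.inr (.inr (.inr (.inr ()))))).neg
      |>.comp_absolutelyContinuousOnInterval (hs.arc.locallyAbsolutelyContinuous j a b hab hsub)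
    have hid : AbsolutelyContinuousOnInterval (fun t : ℝ => t) a b :=
      contDiff_id.contDiffOn.absolutelyContinuousOnInterval
    have := (hac.sub hid).le_of_ae_hasDerivAt_nonpos hab ?_
    · simp only [Pi.sub_apply, Function.comp_apply] at this
      change -timer (φ b j) - b ≤ -timer (φ a j) - a at this
      linarith
    · filter_upwards [ae_restrict_of_ae_restrict_of_subset hsub (hs.flow j)] with t ht
      have hτ : HasDerivAt (fun s => timer (φ s j)) (-1) t :=
        (EuclideanSpace.proj (𝕜 := ℝ)
          (.inr (.inr (.inr (.inr ()))) : StateIdx m)).hasFDerivAt.comp_hasDerivAt t ht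
      exact ⟨_, by norm_num, hτ.neg.sub (hasDerivAt_id t)⟩
  · intro t j hj ht
    obtain ⟨hD, ν, hν, hg⟩ := hs.jump t j hj
    have h1 : timer (φ t j) = 0 := hD.2
    have h2 : timer (φ t (j + 1)) = ν := by rw [hg]; rfl
    rw [h2]
    rw [h1] at ht
    push_cast
    linarith [hν.1]

/-- Grönwall with an integrating factor: `exp(ct) (V - C s² / c)` does not increase along flows or,
at fixed `t`, across jumps. -/
theorem IsSolutionPair.lyapunov_le {V : State m → ℝ} {c C : ℝ} (hT₁ : 0 < T₁) (hc : 0 < c)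
    (hC : 0 < C) (hV : ContDiff ℝ 1 V)
    (hflow : ∀ (ψ : ℝ → State m) (t : ℝ) (σ : EuclideanSpace ℝ (Fin (m + 1))),
      ψ t ∈ stateSet m T₂ → HasDerivAt ψ ((sigmaSystem T₁ T₂ μ h γ Lbar).f (ψ t) σ) t →
      ∃ d ≤ -c * V (ψ t) + C * ‖σ‖ ^ 2, HasDerivAt (fun s => V (ψ s)) d t)
    (hjump : ∀ χ ∈ (sigmaSystem T₁ T₂ μ h γ Lbar).D, ∀ σ,
      ∀ g ∈ (sigmaSystem T₁ T₂ μ h γ Lbar).G χ σ, V g ≤ V χ)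
    (hs : IsSolutionPair (sigmaSystem T₁ T₂ μ h γ Lbar) E φ u) (hu : inputNorm E u < ⊤) :
    ∀ t j, (t, j) ∈ E → V (φ t j) ≤
      Real.exp (-(c * t)) * V (φ 0 0) + C / c * (inputNorm E u).toReal ^ 2 := by
  set s := (inputNorm E u).toReal with hs_def
  have hmem := hs.mem_stateSet hT₁
  have key : ∀ t j, (t, j) ∈ E →
      Real.exp (c * t) * (V (φ t j) - C / c * s ^ 2) ≤ V (φ 0 0) - C / c * s ^ 2 := by
    refine hs.arc.domain.induction
      (P := fun t j => Real.exp (c * t) * (V (φ t j) - C / c * s ^ 2) ≤ V (φ 0 0) - C / c * s ^ 2)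
      (by simp) ?_ ?_
    · intro j a b hab hsub ha
      refine le_trans ?_ ha
      have hVac := hV.comp_absolutelyContinuousOnInterval
        (hs.arc.locallyAbsolutelyContinuous j a b hab hsub)
      have hconst : AbsolutelyContinuousOnInterval (fun _ : ℝ => C / c * s ^ 2) a b :=
        contDiff_const.contDiffOn.absolutelyContinuousOnInterval
      have hexp : AbsolutelyContinuousOnInterval (fun t : ℝ => Real.exp (c * t)) a b :=
        (contDiff_const.mul contDiff_id).exp.contDiffOn.absolutelyContinuousOnInterval
      refine (hexp.mul (hVac.sub hconst)).le_of_ae_hasDerivAt_nonpos hab ?_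
      filter_upwards [ae_restrict_of_ae_restrict_of_subset hsub (hs.flow j),
        ae_restrict_of_ae_restrict_of_subset hsub (ae_norm_le_inputNorm hu j),
        ae_restrict_mem measurableSet_Icc] with t ht hut htab
      obtain ⟨d, hd, hVd⟩ := hflow _ t _ (hmem t j (hsub htab)) ht
      have he : HasDerivAt (fun t : ℝ => Real.exp (c * t)) (Real.exp (c * t) * (c * 1)) t :=
        ((hasDerivAt_id t).const_mul c).exp
      refine ⟨_, ?_, he.mul (hVd.sub (hasDerivAt_const t (C / c * s ^ 2)))⟩
      have hsq : ‖u t j‖ ^ 2 ≤ s ^ 2 := pow_le_pow_left₀ (norm_nonneg _) hut 2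
      have h1 : d ≤ -c * V (φ t j) + C * s ^ 2 :=
        hd.trans (by gcongr)
      have h2 : c * (C / c * s ^ 2) = C * s ^ 2 := by field_simp
      simp only [Pi.sub_apply, Function.comp_apply]
      have h3 : Real.exp (c * t) * (c * 1) * (V (φ t j) - C / c * s ^ 2)
          + Real.exp (c * t) * (d - 0)
          = Real.exp (c * t) * (c * V (φ t j) - c * (C / c * s ^ 2) + d) := by ring
      rw [h3, h2]
      exact mul_nonpos_of_nonneg_of_nonpos (Real.exp_pos _).le (by linarith)
    · intro t j hj ht
      refine le_trans ?_ ht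
      obtain ⟨hD, hG⟩ := hs.jump t j hj
      gcongr
      exact hjump _ hD _ _ hG
  intro t j htj
  have h1 := mul_le_mul_of_nonneg_left (key t j htj) (Real.exp_pos (-(c * t))).le
  rw [← mul_assoc, ← Real.exp_add, neg_add_cancel, Real.exp_zero, one_mul, mul_sub] at h1
  have h2 : 0 ≤ Real.exp (-(c * t)) * (C / c * s ^ 2) := by positivity
  linarith

theorem isISS_of_quadratic_lyapunov {V : State m → ℝ} {a b c C : ℝ} (hT₁ : 0 < T₁) (hT₂ : T₁ ≤ T₂)
    (ha : 0 < a) (hb : 0 < b) (hc : 0 < c) (hC : 0 < C) (hV : ContDiff ℝ 1 V)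
    (hlow : ∀ χ ∈ stateSet m T₂, a * distSq χ ≤ V χ)
    (hup : ∀ χ ∈ stateSet m T₂, V χ ≤ b * distSq χ)
    (hflow : ∀ (ψ : ℝ → State m) (t : ℝ) (σ : EuclideanSpace ℝ (Fin (m + 1))),
      ψ t ∈ stateSet m T₂ → HasDerivAt ψ ((sigmaSystem T₁ T₂ μ h γ Lbar).f (ψ t) σ) t →
      ∃ d ≤ -c * V (ψ t) + C * ‖σ‖ ^ 2, HasDerivAt (fun s => V (ψ s)) d t)
    (hjump : ∀ χ ∈ (sigmaSystem T₁ T₂ μ h γ Lbar).D, ∀ σ,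
      ∀ g ∈ (sigmaSystem T₁ T₂ μ h γ Lbar).G χ σ, V g ≤ V χ) :
    IsISS (sigmaSystem T₁ T₂ μ h γ Lbar) (targetSet m T₂) := by
  have hT₂0 : 0 ≤ T₂ := hT₁.le.trans hT₂
  -- Chosen so that `k (1 + 1/T₁) = c/2`: with `j ≤ (t + T₂)/T₁`, decay at rate `c/2` in `t` becomes
  -- decay at rate `k` in `t + j`, up to the factor `exp(k T₂/T₁)`. Half of `c` appears because `V`
  -- is quadratic in the distance.
  set k : ℝ := c / 2 * (T₁ / (T₁ + 1)) with hk_def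
  have hk : 0 < k := by positivity
  refine ⟨fun r s => √(2 * (b / a)) * Real.exp (k * (T₂ / T₁)) * Real.exp (-(k * s)) * r,
    fun r => √(2 * (C / c / a)) * r, isClassKL_mul_exp_neg (by positivity) hk,
    isClassK_const_mul (by positivity), ?_⟩
  intro E φ u hs hu t j htj
  set s := (inputNorm E u).toReal with hs_def
  have hs0 : 0 ≤ s := ENNReal.toReal_nonneg
  have hmem := hs.mem_stateSet hT₁
  have hE0 : (0, 0) ∈ E := by
    obtain ⟨⟨T, J⟩, hTJ⟩ := hs.arc.domain.nonempty
    obtain ⟨r, hr0, hmono, heq⟩ := hs.arc.domain.truncation T J hTJ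
    have : ((0 : ℝ), 0) ∈ E ∩ (Icc 0 T ×ˢ Iic J) := by
      rw [heq]
      refine ⟨Nat.zero_le _, ?_⟩
      have := hmono 0 (Nat.zero_le _)
      simp only [zero_add] at this
      exact ⟨hr0.le, hr0 ▸ this⟩
    exact this.1
  have h0 := hmem 0 0 hE0
  have hχ := hmem t j htj
  have hcount := hs.jump_count_le h0.1 t j htj
  have hdecay := hs.lyapunov_le hT₁ hc hC hV hflow hjump hu t j htj
  set r := Metric.infDist (φ 0 0) (targetSet m T₂) with hr_def
  have hr0 : 0 ≤ r := Metric.infDist_nonneg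
  have hr : distSq (φ 0 0) ≤ r ^ 2 := distSq_le_infDist_sq hT₂0 _
  refine (infDist_targetSet_le hχ).trans (le_max_of_sq_le_add_sq (by positivity) (by positivity) ?_)
  rw [Real.sq_sqrt (distSq_nonneg _)]
  have hexp : Real.exp (-(c * t)) ≤ (Real.exp (k * (T₂ / T₁)) * Real.exp (-(k * (t + j)))) ^ 2 := by
    rw [← Real.exp_add, ← Real.exp_nat_mul, Real.exp_le_exp]
    have hj : (j : ℝ) ≤ (t + T₂) / T₁ := by
      rw [le_div_iff₀ hT₁]
      linarith [hχ.2]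
    have h1 : k * (t + j) ≤ k * (t + (t + T₂) / T₁) := by gcongr
    have h2 : k * (t + (t + T₂) / T₁) = c / 2 * t + k * (T₂ / T₁) := by
      rw [hk_def]; field_simp; ring
    push_cast
    linarith
  have h1 : a * distSq (φ t j) ≤ Real.exp (-(c * t)) * (b * r ^ 2) + C / c * s ^ 2 := by
    refine (hlow _ hχ).trans (hdecay.trans ?_)
    gcongr
    exact (hup _ h0).trans (by gcongr)
  have h2 : distSq (φ t j) ≤ Real.exp (-(c * t)) * (b / a * r ^ 2) + C / c / a * s ^ 2 := by
    rw [← mul_le_mul_iff_right₀ ha]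
    refine h1.trans (le_of_eq ?_)
    field_simp
  have e1 : (√(2 * (b / a)) * Real.exp (k * (T₂ / T₁)) * Real.exp (-(k * (t + j))) * r) ^ 2
      = 2 * (b / a) * (Real.exp (k * (T₂ / T₁)) * Real.exp (-(k * (t + j)))) ^ 2 * r ^ 2 := by
    rw [mul_assoc (√(2 * (b / a))), mul_pow, mul_pow, Real.sq_sqrt (by positivity)]
  have e2 : (√(2 * (C / c / a)) * s) ^ 2 = 2 * (C / c / a) * s ^ 2 := by
    rw [mul_pow, Real.sq_sqrt (by positivity)]
  rw [e1, e2]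
  have h3 : Real.exp (-(c * t)) * (b / a * r ^ 2) ≤
      (Real.exp (k * (T₂ / T₁)) * Real.exp (-(k * (t + j)))) ^ 2 * (b / a * r ^ 2) := by gcongr
  linarith

end solutions

/-! ### Verification of the Lyapunov inequalities along flows and at jumps -/

section lyap

variable {m : ℕ}

theorem dotProduct_self_flow_input_le (w : Blk m → ℝ) (σ : EuclideanSpace ℝ (Fin (m + 1))) :
    (Bf2 m *ᵥ w + Sum.elim (fun i => σ (Fin.succ i)) (fun _ => 0)) ⬝ᵥ
      (Bf2 m *ᵥ w + Sum.elim (fun i => σ (Fin.succ i)) (fun _ => 0)) ≤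
      2 * (w ⬝ᵥ w) + 2 * ‖σ‖ ^ 2 := by
  have h1 : Bf2 m *ᵥ w = Sum.elim (fun i => w (.inl i)) 0 := by
    rw [Bf2, fromBlocks_mulVec]
    simp [Function.comp_def]
  rw [h1, EuclideanSpace.norm_sq_eq, Fin.sum_univ_succ]
  simp only [dotProduct, Fintype.sum_sum_type, Pi.add_apply, Sum.elim_inl, Sum.elim_inr,
    Pi.zero_apply, add_zero, mul_zero, Finset.sum_const_zero, Real.norm_eq_abs, sq_abs]
  have h2 : ∑ i : Fin m, (w (.inl i) + σ i.succ) * (w (.inl i) + σ i.succ) ≤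
      2 * ∑ i : Fin m, w (.inl i) * w (.inl i) + 2 * ∑ i : Fin m, σ i.succ ^ 2 := by
    rw [Finset.mul_sum, Finset.mul_sum, ← Finset.sum_add_distrib]
    exact Finset.sum_le_sum fun i _ => by nlinarith [sq_nonneg (w (.inl i) - σ i.succ)]
  have h3 : 0 ≤ ∑ i : Fin m, w (.inr i) * w (.inr i) :=
    Finset.sum_nonneg fun i _ => mul_self_nonneg _
  nlinarith [sq_nonneg (σ 0)]

theorem two_mul_dotProduct_mulVec_Af4_le {μ β₂ : ℝ} {P₃ : Matrix (Blk m) (Blk m) ℝ}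
    (hP₃ : P₃.PosDef)
    (hβ₂P₃ : (-(β₂ • (1 : Matrix (Blk m) (Blk m) ℝ)) -
      (P₃ * Af4 m μ + (Af4 m μ)ᵀ * P₃)).PosSemidef) (w : Blk m → ℝ) :
    2 * (w ⬝ᵥ P₃ *ᵥ (Af4 m μ *ᵥ w)) ≤ -β₂ * (w ⬝ᵥ w) := by
  have h1 := quad_nonneg hβ₂P₃ w
  have h2 : w ⬝ᵥ (Af4 m μ)ᵀ *ᵥ (P₃ *ᵥ w) = w ⬝ᵥ P₃ *ᵥ (Af4 m μ *ᵥ w) := by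
    rw [dotProduct_mulVec, vecMul_transpose, dotProduct_mulVec_comm_of_isHermitian hP₃.1]
  simp only [quad, sub_mulVec, neg_mulVec, add_mulVec, smul_mulVec, one_mulVec, dotProduct_sub,
    dotProduct_neg, dotProduct_smul, dotProduct_add, smul_eq_mul, ← mulVec_mulVec] at h1
  rw [h2] at h1
  linarith

/-- Compactness of `[T₁, T₂]` turns pointwise definiteness into a uniform margin in `|x|²`; dividing
by an upper bound of `P₁` makes it a relative decrease. -/
theorem exists_quad_jump_le {T₁ T₂ h γ : ℝ} {Lbar : Matrix (Fin m) (Fin m) ℝ}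
    {P₁ : Matrix (Blk m) (Blk m) ℝ}
    (hjump : ∀ ν ∈ Set.Icc T₁ T₂, (-jumpForm h γ Lbar P₁ ν).PosDef) :
    ∃ δ > 0, ∀ ν ∈ Icc T₁ T₂, ∀ x,
      quad P₁ (NormedSpace.exp (ν • Af2 m h) *ᵥ (Ag2 γ Lbar *ᵥ x)) ≤ (1 - δ) * quad P₁ x := by
  have hcont : Continuous fun ν => -jumpForm h γ Lbar P₁ ν :=
    (((continuous_const.matrix_mul (continuous_expConj h P₁)).matrix_mul continuous_const).sub
      continuous_const).neg
  obtain ⟨δ, hδ, H⟩ := exists_pos_forall_le_quad isCompact_Icc hcont.continuousOn hjump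
  obtain ⟨C, hC, HC⟩ := exists_pos_forall_quad_le (M := fun _ => P₁) (K := {0}) isCompact_singleton
    continuousOn_const
  refine ⟨δ / C, by positivity, fun ν hν x => ?_⟩
  have h1 := H ν hν x
  have h2 := HC 0 rfl x
  rw [quad_neg, jumpForm, quad_sub, ← quad_mulVec, ← quad_exp_mulVec] at h1
  have h3 : δ / C * quad P₁ x ≤ δ * (x ⬝ᵥ x) := by
    rw [div_mul_eq_mul_div, div_le_iff₀ hC, mul_assoc, mul_comm _ C]
    gcongr
  linarith

theorem exp_mul_bounds {h τ T : ℝ} (hτ : τ ∈ Icc 0 T) :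
    Real.exp (-(|h| * T)) ≤ Real.exp (h * τ) ∧ Real.exp (h * τ) ≤ Real.exp (|h| * T) := by
  have h1 : |h * τ| ≤ |h| * T := by
    rw [abs_mul, abs_of_nonneg hτ.1]
    exact mul_le_mul_of_nonneg_left hτ.2 (abs_nonneg h)
  exact ⟨Real.exp_le_exp.2 (abs_le.1 h1).1, Real.exp_le_exp.2 (abs_le.1 h1).2⟩

/-- The jump condition on `P₁` and the Lyapunov inequality for `P₃` already give input-to-state
stability: the system is a cascade in which `w₁, w₂` decay exponentially and drive `z₁, z₂`, so the
weight `K` of the `w₂`-part of the Lyapunov function can be chosen large, and no small-gain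
condition is needed. -/
theorem isISS_sigmaSystem {T₁ T₂ μ h γ β₂ : ℝ} {Lbar : Matrix (Fin m) (Fin m) ℝ}
    (hT₁ : 0 < T₁) (hT₂ : T₁ ≤ T₂) (hμ : 0 < μ)
    {P₁ P₃ : Matrix (Blk m) (Blk m) ℝ} (hP₁ : P₁.PosDef) (hP₃ : P₃.PosDef)
    (hjump : ∀ ν ∈ Set.Icc T₁ T₂, (-jumpForm h γ Lbar P₁ ν).PosDef) (hβ₂ : 0 < β₂)
    (hβ₂P₃ : (-(β₂ • (1 : Matrix (Blk m) (Blk m) ℝ)) -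
      (P₃ * Af4 m μ + (Af4 m μ)ᵀ * P₃)).PosSemidef) :
    IsISS (sigmaSystem T₁ T₂ μ h γ Lbar) (targetSet m T₂) := by
  have hT₂0 : 0 < T₂ := hT₁.trans_le hT₂
  obtain ⟨δ, hδ, hδjump⟩ := exists_quad_jump_le hjump
  obtain ⟨q, hq, hqle⟩ := exists_pos_forall_le_quad (isCompact_Icc (a := 0) (b := T₂))
    (continuous_expConj h P₁).continuousOn fun ν _ => expConj_posDef hP₁ h ν
  obtain ⟨Q, hQ, hleQ⟩ := exists_pos_forall_quad_le (isCompact_Icc (a := 0) (b := T₂))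
    (continuous_expConj h P₁).continuousOn
  -- For a constant matrix the parameter set is a dummy point.
  obtain ⟨p, hp, hple⟩ := exists_pos_forall_le_quad (M := fun _ => P₃) (K := {0})
    isCompact_singleton continuousOn_const fun _ _ => hP₃
  obtain ⟨P, hP, hleP⟩ := exists_pos_forall_quad_le (M := fun _ => P₃) (K := {0})
    isCompact_singleton continuousOn_const
  replace hple := hple 0 rfl
  replace hleP := hleP 0 rfl
  -- The rate for which `exp(lam τ)` reaches `1 + δ` exactly at `τ = T₂`; the jump then costs at
  -- most `(1 + δ)(1 - δ) ≤ 1`.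
  set lam : ℝ := Real.log (1 + δ) / T₂ with hlam_def
  have hlam : 0 < lam := div_pos (Real.log_pos (by linarith)) hT₂0
  have hexp : ∀ τ ∈ Icc 0 T₂, 1 ≤ Real.exp (lam * τ) ∧ Real.exp (lam * τ) ≤ 1 + δ := by
    intro τ hτ
    refine ⟨Real.one_le_exp (mul_nonneg hlam.le hτ.1), ?_⟩
    rw [← Real.exp_log (show 0 < 1 + δ by linarith), Real.exp_le_exp]
    calc lam * τ ≤ lam * T₂ := by gcongr; exact hτ.2
      _ = Real.log (1 + δ) := by rw [hlam_def]; field_simp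
  -- Bound for the weight, times the Young constant, times the bound for the form evaluated at the
  -- forcing. It multiplies both `|w2|²` and `|σ|²`.
  set R : ℝ := (1 + δ) * ((lam / 2)⁻¹ * (2 * Q)) with hR_def
  have hR : 0 < R := by positivity
  -- `K β₂ = R + 1`: the part `R` absorbs the coupling into `z2`, and the surplus 1 gives decay of
  -- the `w2` part.
  set K : ℝ := (R + 1) / β₂ with hK_def
  have hK : 0 < K := by positivity
  set U : ℝ := 2 + 2 * μ + μ * (μ + 2) with hU_def
  have hU : 0 < U := by positivity
  set e₀ : ℝ := Real.exp (-(|h| * T₂)) with he₀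
  set e₁ : ℝ := Real.exp (|h| * T₂) with he₁
  set a : ℝ := min (min (e₀ ^ 2) q) (min (K * p) (min 2 (μ ^ 2))) with ha_def
  set b : ℝ := max ((1 + δ) * max (e₁ ^ 2) Q) (max (K * P) U) with hb_def
  -- The decay rates left for the three parts: half of `lam` after Young, the surplus for `w2`, and
  -- the rate for `w1`.
  set c : ℝ := min (lam / 2) (min (1 / (K * P)) (2 * μ / U)) with hc_def
  have hc : 0 < c := by positivity
  have hy : ∀ χ : State m, 0 ≤ quad P₁ (NormedSpace.exp (timer χ • Af2 m h) *ᵥ z2 χ) :=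
    fun χ => quad_nonneg hP₁.posSemidef _
  have hS : ∀ χ : State m, 0 ≤ (Real.exp (h * timer χ) * z1 χ 1) ^ 2
      + quad P₁ (NormedSpace.exp (timer χ • Af2 m h) *ᵥ z2 χ) :=
    fun χ => add_nonneg (sq_nonneg _) (hy χ)
  refine isISS_of_quadratic_lyapunov (V := lyap h μ lam K P₁ P₃) (a := a) (b := b) (c := c) (C := R)
    hT₁ hT₂ (by positivity) (by positivity) hc hR (contDiff_lyap h μ lam K P₁ P₃) ?_ ?_ ?_ ?_
  · intro χ hχ
    have h1 : a * (z1 χ 1 ^ 2) ≤ (Real.exp (h * timer χ) * z1 χ 1) ^ 2 := by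
      rw [mul_pow]
      have : a ≤ Real.exp (h * timer χ) ^ 2 :=
        ((min_le_left _ _).trans (min_le_left _ _)).trans
          (pow_le_pow_left₀ (Real.exp_pos _).le (exp_mul_bounds hχ).1 2)
      gcongr
    have h2 : a * (z2 χ ⬝ᵥ z2 χ) ≤ quad P₁ (NormedSpace.exp (timer χ • Af2 m h) *ᵥ z2 χ) := by
      rw [quad_exp_mulVec]
      exact (mul_le_mul_of_nonneg_right ((min_le_left _ _).trans (min_le_right _ _))
        (dotProduct_self_nonneg' _)).trans (hqle _ hχ _)
    have h3 : a * (w2 χ ⬝ᵥ w2 χ) ≤ K * quad P₃ (w2 χ) := by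
      refine (mul_le_mul_of_nonneg_right ((min_le_right _ _).trans (min_le_left _ _))
        (dotProduct_self_nonneg' _)).trans ?_
      rw [mul_assoc]
      exact mul_le_mul_of_nonneg_left (hple _) hK.le
    have h4 : a * (w1 χ ⬝ᵥ w1 χ) ≤ quadAf3 μ (w1 χ) := by
      refine (mul_le_mul_of_nonneg_right ((min_le_right _ _).trans (min_le_right _ _))
        (dotProduct_self_nonneg' _)).trans (quadAf3_ge (w1 χ) |>.trans ?_)
      have : 0 ≤ μ * (w1 χ 0 + w1 χ 1) ^ 2 := by positivity
      linarith
    have h5 := mul_le_mul_of_nonneg_right (hexp _ hχ).1 (hS χ)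
    rw [distSq, lyap]
    linarith
  · intro χ hχ
    have h1 : (Real.exp (h * timer χ) * z1 χ 1) ^ 2 ≤ max (e₁ ^ 2) Q * (z1 χ 1 ^ 2) := by
      rw [mul_pow]
      have : Real.exp (h * timer χ) ^ 2 ≤ max (e₁ ^ 2) Q :=
        (pow_le_pow_left₀ (Real.exp_pos _).le (exp_mul_bounds hχ).2 2).trans (le_max_left _ _)
      gcongr
    have h2 : quad P₁ (NormedSpace.exp (timer χ • Af2 m h) *ᵥ z2 χ) ≤
        max (e₁ ^ 2) Q * (z2 χ ⬝ᵥ z2 χ) := by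
      rw [quad_exp_mulVec]
      exact (hleQ _ hχ _).trans (mul_le_mul_of_nonneg_right (le_max_right _ _)
        (dotProduct_self_nonneg' _))
    have h3 : K * quad P₃ (w2 χ) ≤ b * (w2 χ ⬝ᵥ w2 χ) := by
      refine le_trans ?_ (mul_le_mul_of_nonneg_right ((le_max_left _ _).trans (le_max_right _ _))
        (dotProduct_self_nonneg' _))
      rw [mul_assoc]
      exact mul_le_mul_of_nonneg_left (hleP _) hK.le
    have h4 : quadAf3 μ (w1 χ) ≤ b * (w1 χ ⬝ᵥ w1 χ) :=
      (quadAf3_le hμ _).trans (mul_le_mul_of_nonneg_right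
        ((le_max_right _ _).trans (le_max_right _ _)) (dotProduct_self_nonneg' _))
    have h5 : Real.exp (lam * timer χ) * ((Real.exp (h * timer χ) * z1 χ 1) ^ 2
        + quad P₁ (NormedSpace.exp (timer χ • Af2 m h) *ᵥ z2 χ)) ≤
        b * (z1 χ 1 ^ 2 + z2 χ ⬝ᵥ z2 χ) := by
      have hD : 0 ≤ z1 χ 1 ^ 2 + z2 χ ⬝ᵥ z2 χ :=
        add_nonneg (sq_nonneg _) (dotProduct_self_nonneg' _)
      calc _ ≤ (1 + δ) * (max (e₁ ^ 2) Q * (z1 χ 1 ^ 2 + z2 χ ⬝ᵥ z2 χ)) :=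
            mul_le_mul (hexp _ hχ).2 (by rw [mul_add]; exact add_le_add h1 h2) (hS χ)
              (by positivity)
        _ ≤ b * (z1 χ 1 ^ 2 + z2 χ ⬝ᵥ z2 χ) := by
            rw [← mul_assoc]
            exact mul_le_mul_of_nonneg_right (le_max_left _ _) hD
    rw [distSq, lyap]
    linarith
  · intro ψ t σ hχ hψ
    refine ⟨_, ?_, hasDerivAt_lyap hP₁ hP₃ hψ⟩
    generalize ψ t = χ at hχ
    have hyoung := two_mul_dotProduct_mulVec_le hP₁.posSemidef (half_pos hlam)
      (NormedSpace.exp (timer χ • Af2 m h) *ᵥ z2 χ)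
      (NormedSpace.exp (timer χ • Af2 m h) *ᵥ
        (Bf2 m *ᵥ w2 χ + Sum.elim (fun i => σ (Fin.succ i)) (fun _ => 0)))
    have hin : quad P₁ (NormedSpace.exp (timer χ • Af2 m h) *ᵥ
        (Bf2 m *ᵥ w2 χ + Sum.elim (fun i => σ (Fin.succ i)) (fun _ => 0))) ≤
        2 * Q * (w2 χ ⬝ᵥ w2 χ + ‖σ‖ ^ 2) := by
      rw [quad_exp_mulVec]
      refine (hleQ _ hχ _).trans ?_
      have := mul_le_mul_of_nonneg_left (dotProduct_self_flow_input_le (w2 χ) σ) hQ.le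
      linarith
    have hw2 := mul_le_mul_of_nonneg_left (two_mul_dotProduct_mulVec_Af4_le hP₃ hβ₂P₃ (w2 χ)) hK.le
    have hKβ : K * (-β₂ * (w2 χ ⬝ᵥ w2 χ)) = -(R + 1) * (w2 χ ⬝ᵥ w2 χ) := by
      rw [hK_def]; field_simp
    obtain ⟨he1, he2⟩ := hexp _ hχ
    have hη : 0 ≤ lam / 2 * (Real.exp (h * timer χ) * z1 χ 1) ^ 2 := by positivity
    have hWs : 0 ≤ w2 χ ⬝ᵥ w2 χ + ‖σ‖ ^ 2 :=
      add_nonneg (dotProduct_self_nonneg' _) (sq_nonneg _)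
    have hSχ := hS χ
    have hw2n := dotProduct_self_nonneg' (w2 χ)
    have hw1n := dotProduct_self_nonneg' (w1 χ)
    have hcw2 : c * (K * quad P₃ (w2 χ)) ≤ w2 χ ⬝ᵥ w2 χ := by
      have hc2 : c ≤ 1 / (K * P) := (min_le_right _ _).trans (min_le_left _ _)
      calc c * (K * quad P₃ (w2 χ)) ≤ c * (K * (P * (w2 χ ⬝ᵥ w2 χ))) := by
            gcongr; exact hleP _
        _ = c * (K * P) * (w2 χ ⬝ᵥ w2 χ) := by ring
        _ ≤ 1 * (w2 χ ⬝ᵥ w2 χ) := by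
            gcongr
            exact (le_div_iff₀ (by positivity)).1 hc2
        _ = w2 χ ⬝ᵥ w2 χ := one_mul _
    have hcw1 : c * quadAf3 μ (w1 χ) ≤ 2 * μ * (w1 χ ⬝ᵥ w1 χ) := by
      have hc3 : c ≤ 2 * μ / U := (min_le_right _ _).trans (min_le_right _ _)
      calc c * quadAf3 μ (w1 χ) ≤ c * (U * (w1 χ ⬝ᵥ w1 χ)) := by
            gcongr; exact quadAf3_le hμ _
        _ = c * U * (w1 χ ⬝ᵥ w1 χ) := by ring
        _ ≤ 2 * μ * (w1 χ ⬝ᵥ w1 χ) :=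
            mul_le_mul_of_nonneg_right ((le_div_iff₀ hU).1 hc3) hw1n
    have hc1 : c ≤ lam / 2 := min_le_left _ _
    rw [lyap]
    set ex := Real.exp (lam * timer χ)
    set S := (Real.exp (h * timer χ) * z1 χ 1) ^ 2
      + quad P₁ (NormedSpace.exp (timer χ • Af2 m h) *ᵥ z2 χ) with hS_def
    have hcS : c * (ex * S) ≤ lam / 2 * (ex * S) := by gcongr
    have hcross : ex * (2 * (NormedSpace.exp (timer χ • Af2 m h) *ᵥ z2 χ ⬝ᵥ P₁ *ᵥ
        (NormedSpace.exp (timer χ • Af2 m h) *ᵥ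
          (Bf2 m *ᵥ w2 χ + Sum.elim (fun i => σ (Fin.succ i)) (fun _ => 0))))) ≤
        lam / 2 * (ex * S) + R * (w2 χ ⬝ᵥ w2 χ + ‖σ‖ ^ 2) := by
      have h1 : 2 * (NormedSpace.exp (timer χ • Af2 m h) *ᵥ z2 χ ⬝ᵥ P₁ *ᵥ
        (NormedSpace.exp (timer χ • Af2 m h) *ᵥ
          (Bf2 m *ᵥ w2 χ + Sum.elim (fun i => σ (Fin.succ i)) (fun _ => 0)))) ≤
          lam / 2 * S + (lam / 2)⁻¹ * (2 * Q * (w2 χ ⬝ᵥ w2 χ + ‖σ‖ ^ 2)) := by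
        have := mul_le_mul_of_nonneg_left hin (inv_pos.2 (half_pos hlam)).le
        rw [hS_def, mul_add]
        linarith
      have h2 := mul_le_mul_of_nonneg_left h1 (zero_le_one.trans he1)
      have h3 : ex * ((lam / 2)⁻¹ * (2 * Q * (w2 χ ⬝ᵥ w2 χ + ‖σ‖ ^ 2))) ≤
          (1 + δ) * ((lam / 2)⁻¹ * (2 * Q * (w2 χ ⬝ᵥ w2 χ + ‖σ‖ ^ 2))) := by gcongr
      rw [hR_def]
      linarith
    linarith
  · rintro χ ⟨hχ, hτ⟩ σ g ⟨ν, hν, rfl⟩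
    have hν' : ν ∈ Icc 0 T₂ := ⟨hT₁.le.trans hν.1, hν.2⟩
    have e1 : z1 (mkState (Ag1 *ᵥ z1 χ) (Ag2 γ Lbar *ᵥ z2 χ) (w1 χ) (w2 χ) ν) 1 = 0 := by
      change (Ag1 *ᵥ z1 χ) 1 = 0
      simp [Ag1, dotProduct, Fin.sum_univ_two]
    have e2 : z2 (mkState (Ag1 *ᵥ z1 χ) (Ag2 γ Lbar *ᵥ z2 χ) (w1 χ) (w2 χ) ν) =
      Ag2 γ Lbar *ᵥ z2 χ := rfl
    have e3 : w1 (mkState (Ag1 *ᵥ z1 χ) (Ag2 γ Lbar *ᵥ z2 χ) (w1 χ) (w2 χ) ν) = w1 χ := rfl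
    have e4 : w2 (mkState (Ag1 *ᵥ z1 χ) (Ag2 γ Lbar *ᵥ z2 χ) (w1 χ) (w2 χ) ν) = w2 χ := rfl
    have e5 : timer (mkState (Ag1 *ᵥ z1 χ) (Ag2 γ Lbar *ᵥ z2 χ) (w1 χ) (w2 χ) ν) = ν := rfl
    rw [lyap, lyap, e1, e2, e3, e4, e5, hτ]
    have h1 := hδjump ν hν (z2 χ)
    have hn : 0 ≤ quad P₁ (NormedSpace.exp (ν • Af2 m h) *ᵥ (Ag2 γ Lbar *ᵥ z2 χ)) :=
      quad_nonneg hP₁.posSemidef _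
    have hn2 : 0 ≤ quad P₁ (z2 χ) := quad_nonneg hP₁.posSemidef _
    have h2 : Real.exp (lam * ν) * quad P₁ (NormedSpace.exp (ν • Af2 m h) *ᵥ
        (Ag2 γ Lbar *ᵥ z2 χ)) ≤ quad P₁ (z2 χ) :=
      calc _ ≤ (1 + δ) * quad P₁ (NormedSpace.exp (ν • Af2 m h) *ᵥ (Ag2 γ Lbar *ᵥ z2 χ)) := by
            gcongr; exact (hexp ν hν').2
        _ ≤ (1 + δ) * ((1 - δ) * quad P₁ (z2 χ)) := by gcongr
        _ ≤ quad P₁ (z2 χ) := by nlinarith [mul_nonneg (sq_nonneg δ) hn2]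
    -- The jump resets this entry to zero, so its contribution before the jump is simply dropped.
    have h3 : 0 ≤ (1 * z1 χ 1) ^ 2 := sq_nonneg _
    simp only [mul_zero, Real.exp_zero, zero_smul, NormedSpace.exp_zero, one_mulVec, one_mul,
      ne_eq, OfNat.ofNat_ne_zero, not_false_eq_true, zero_pow, zero_add] at h3 ⊢
    linarith

end lyap

end HyNTP

theorem theorem4 (m : ℕ) (𝒢 : Digraph (Fin (m + 1))) (h𝒢 : IsStronglyConnected 𝒢)
    (𝒯 : Matrix (Fin (m + 1)) (Fin (m + 1)) ℝ) (Lbar : Matrix (Fin m) (Fin m) ℝ)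
    (h𝒯 : IsLaplacianTransform (laplacian 𝒢) 𝒯 Lbar)
    (T₁ T₂ μ h γ : ℝ) (hT₁ : 0 < T₁) (hT₂ : T₁ ≤ T₂) (hμ : 0 < μ) (hγ : 0 < γ)
    (P₁ : Matrix (Blk m) (Blk m) ℝ) (P₂ : Matrix (Fin 2) (Fin 2) ℝ)
    (P₃ : Matrix (Blk m) (Blk m) ℝ)
    (hP₁ : P₁.PosDef) (hP₂ : P₂.PosDef) (hP₃ : P₃.PosDef)
    (hjump : ∀ ν ∈ Set.Icc T₁ T₂, (-jumpForm h γ Lbar P₁ ν).PosDef)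
    (κ₂ ϵ β₂ : ℝ) (hϵ : 0 < ϵ) (hβ₂ : 0 < β₂)
    (hβ₂P₃ : (-(β₂ • (1 : Matrix (Blk m) (Blk m) ℝ)) -
      (P₃ * Af4 m μ + (Af4 m μ)ᵀ * P₃)).PosSemidef)
    (hκ₂ : κ₂ ∈ Set.Ioo 0 (kappa2Bound T₁ T₂ h γ Lbar P₁))
    (hcond : |Real.exp (kappaBar1 T₂ h P₁ ϵ β₂ / alpha2 T₂ h P₁ P₂ P₃ * T₂) *
      (1 - min 1 κ₂ / alpha2 T₂ h P₁ P₂ P₃)| < 1) :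
    IsISS (sigmaSystem T₁ T₂ μ h γ Lbar) (targetSet m T₂) :=
  isISS_sigmaSystem hT₁ hT₂ hμ hP₁ hP₃ hjump hβ₂ hβ₂P₃
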